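/- Let $A$ be a $C^*$-algebra, let $M$ be a correspondence over $A$ (a right Hilbert $A$-module with a left action of $A$ given by a $*$-homomorphism $A\to\mathcal L(M)$), let $Y$ be a right Hilbert $A$-module, and let $T:Y\to Y\otimes_A M$ be an inner-product preserving adjointable map. All tensor products are internal tensor products: $X\otimes_A M$ is the completion of the algebraic tensor product in the inner product $\langle x\otimes m,y\otimes n\rangle=\langle\langle y,x\rangle\cdot m,n\rangle$. Write $Y\otimes_A M^{\otimes 0}=Y$, $Y\otimes_A M^{\otimes(k+1)}=(Y\otimes_A M^{\otimes k})\otimes_A M$, and $T_k:=T\otimes\mathrm{id}_k:Y\otimes_A M^{\otimes k}\to Y\otimes_A M^{\otimes(k+1)}$. For a Hilbert-module isomorphism $U:X\to X\otimes_A M$ let $U^k:X\to X\otimes_A M^{\otimes k}$ be the isomorphisms with $U^0=\mathrm{id}$ and $U^{k+1}=(U\otimes\mathrm{id}_k)\circ U^k$, and let $U^{-k}$ be the inverse of $U^k$. For a closed submodule $V\subseteq X$, $V\otimes_A M^{\otimes k}$ is regarded as a closed submodule of $X\otimes_A M^{\otimes k}$. The direct limit of a sequence $(X_k,T_k)$ of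 Hilbert $A$-modules and inner-product preserving maps is a Hilbert $A$-module $X_\infty$ with inner-product preserving maps $\iota^k:X_k\to X_\infty$ such that $\iota^{k+1}\circ T_k=\iota^k$ and such that, whenever $S_k:X_k\to Z$ are bounded $A$-module homomorphisms into a Hilbert $A$-module $Z$ with $S_{k+1}\circ T_k=S_k$ and $\|S_k\|\le C$ for all $k$, there is a unique bounded $A$-module homomorphism $S_\infty:X_\infty\to Z$ with $\|S_\infty\|\le C$ and $S_\infty\circ\iota^k=S_k$ for all $k$. Then the direct limit $(Y_\infty,\iota^k)=\varinjlim(Y\otimes_A M^{\otimes k},T_k)$ exists, and the following hold. (a) There is a Hilbert-module isomorphism $R$ of $Y_\infty$ onto $Y_\infty\otimes_A M$ such that $R\circ\iota^{k+1}=\iota^k\otimes\mathrm{id}$ for all $k\ge 0$. The closed submodules $Y_k:=\iota^k(Y\otimes_A M^{\otimes k})$ of $Y_\infty$ satisfy: (i) $Y_0$ is an (orthogonally) complemented $A$-submodule of $Y_\infty$; (ii) $Y_k=R^{-k}(Y_0\otimes_A M^{\otimes k})$ for $k\ge 0$; (iii) $Y_k$ is a complemented submodule of $Y_{k+1}$ for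 $k\ge 0$; (iv) $\bigcup_{k\ge 0}Y_k$ is dense in $Y_\infty$. (b) Suppose that $X$ is a Hilbert $A$-module, $D:X\to X\otimes_A M$ is a Hilbert-module isomorphism, and $Q_0:Y\to X$ is an inner-product preserving map such that $D\circ Q_0=(Q_0\otimes\mathrm{id})\circ T$. Then there is an inner-product preserving map $Q:Y_\infty\to X$ such that $Q\circ\iota^0=Q_0$ and $D\circ Q=(Q\otimes\mathrm{id})\circ R$. The submodules $V_k:=Q(Y_k)$ of the closed submodule $Q(Y_\infty)$ of $X$ satisfy $$V_k=D^{-k}\circ(Q_0\otimes\mathrm{id}_k)(Y\otimes_A M^{\otimes k})\qquad(k\ge 0),$$ and moreover: $V_0$ is complemented in $Q(Y_\infty)$; $V_k=D^{-k}(V_0\otimes_A M^{\otimes k})$ for $k\ge 0$; $V_k$ is complemented in $V_{k+1}$ for $k\ge 0$; and $\bigcup_{k\ge 0}V_k$ is dense in $Q(Y_\infty)$. -/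

import Mathlib

universe u v

noncomputable section

open scoped TensorProduct
open MulOpposite

/-- A right Hilbert module over the C⋆-algebra `A`: a complete Hilbert C⋆-module. Mathlib's
`CStarModule B E` has `⟪x, b • y⟫ = b * ⟪x, y⟫`, so a *right* Hilbert `A`-module, in which
`⟪x, y · a⟫ = ⟪x, y⟫ * a`, is a `CStarModule` over `Aᵐᵒᵖ` (with `y · a = op a • y`). -/
structure HilbertModule (A : Type u) [NonUnitalCStarAlgebra A] [PartialOrder A] where
  carrier : Type v
  [normedAddCommGroup : NormedAddCommGroup carrier]
  [normedSpace : NormedSpace ℂ carrier]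
  [completeSpace : CompleteSpace carrier]
  [rightAction : SMul Aᵐᵒᵖ carrier]
  [cstarModule : CStarModule Aᵐᵒᵖ carrier]

namespace HilbertModule

variable {A : Type u} [NonUnitalCStarAlgebra A] [PartialOrder A]

instance : CoeSort (HilbertModule.{u, v} A) (Type v) := ⟨carrier⟩

attribute [instance] normedAddCommGroup normedSpace completeSpace rightAction cstarModule

variable {X : HilbertModule.{u, v} A}

/-- The `A`-valued inner product `⟨x, y⟩`, linear in the second variable. -/
def ip (x y : X) : A := unop (inner Aᵐᵒᵖ x y)

/-- The right action `x · a`. -/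
def ract (x : X) (a : A) : X := op a • x

lemma ip_add_right (x y z : X) : ip x (y + z) = ip x y + ip x z := by simp [ip]
lemma ip_add_left (x y z : X) : ip (x + y) z = ip x z + ip y z := by simp [ip]
lemma ip_sub_right (x y z : X) : ip x (y - z) = ip x y - ip x z := by simp [ip]
lemma ip_sub_left (x y z : X) : ip (x - y) z = ip x z - ip y z := by simp [ip]
lemma ip_smul_right (c : ℂ) (x y : X) : ip x (c • y) = c • ip x y := by simp [ip]
lemma ip_smul_left (c : ℂ) (x y : X) : ip (c • x) y = star c • ip x y := by simp [ip]
lemma ip_ract_right (x y : X) (a : A) : ip x (ract y a) = ip x y * a := by simp [ip, ract]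
lemma star_ip (x y : X) : star (ip x y) = ip y x := by
  rw [ip, ip, ← CStarModule.star_inner (A := Aᵐᵒᵖ) x y]; rfl
lemma ip_ract_left (x y : X) (a : A) : ip (ract x a) y = star a * ip x y := by
  rw [← star_ip, ip_ract_right, star_mul, star_ip]
lemma ip_self_nonneg (x : X) : 0 ≤ ip x x := CStarModule.inner_self_nonneg (A := Aᵐᵒᵖ) (x := x)
lemma ip_self_eq_zero (x : X) : ip x x = 0 ↔ x = 0 := by
  rw [ip, unop_eq_zero_iff, CStarModule.inner_self]
lemma norm_eq (x : X) : ‖x‖ = √‖ip x x‖ :=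
  CStarModule.norm_eq_sqrt_norm_inner_self (A := Aᵐᵒᵖ) x

lemma ip_sum_right {κ : Type*} (s : Finset κ) (x : X) (f : κ → X) :
    ip x (∑ i ∈ s, f i) = ∑ i ∈ s, ip x (f i) := by
  simp [ip]
lemma ip_sum_left {κ : Type*} (s : Finset κ) (x : X) (f : κ → X) :
    ip (∑ i ∈ s, f i) x = ∑ i ∈ s, ip (f i) x := by
  simp [ip]

lemma ext_ip {x y : X} (h : ∀ z : X, ip z x = ip z y) : x = y := by
  rw [← sub_eq_zero, ← ip_self_eq_zero, ip_sub_right, h, sub_self]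

lemma ract_add (x y : X) (a : A) : ract (x + y) a = ract x a + ract y a :=
  ext_ip fun z => by simp only [ip_ract_right, ip_add_right, add_mul]
lemma ract_smul (c : ℂ) (x : X) (a : A) : ract (c • x) a = c • ract x a :=
  ext_ip fun z => by simp only [ip_ract_right, ip_smul_right, smul_mul_assoc]

end HilbertModule

open HilbertModule

/-- A correspondence over `A`: a right Hilbert `A`-module with a left action of `A` given by a
`*`-homomorphism of `A` into the adjointable operators. -/
structure Correspondence (A : Type u) [NonUnitalCStarAlgebra A] [PartialOrder A]
    extends HilbertModule.{u, v} A where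
  left : A →ₙₐ[ℂ] (carrier →L[ℂ] carrier)
  ip_left : ∀ (a : A) (m n : carrier),
    HilbertModule.ip (X := toHilbertModule) (left a m) n
      = HilbertModule.ip (X := toHilbertModule) m (left (star a) n)

section Gram

variable {A : Type u} [NonUnitalCStarAlgebra A] [PartialOrder A] [StarOrderedRing A]

lemma exists_posPart_negPart {B : Type*} [NonUnitalCStarAlgebra B] [PartialOrder B]
    [StarOrderedRing B] (g : B) (hg : IsSelfAdjoint g) :
    ∃ c d : B, g = star c * c - star d * d ∧ star c * c * (star d * d) = 0 := by
  obtain ⟨c, hc⟩ := CStarAlgebra.nonneg_iff_eq_star_mul_self.mp (CFC.posPart_nonneg g)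
  obtain ⟨d, hd⟩ := CStarAlgebra.nonneg_iff_eq_star_mul_self.mp (CFC.negPart_nonneg g)
  refine ⟨c, d, ?_, ?_⟩
  · rw [← hc, ← hd, CFC.posPart_sub_negPart g hg]
  · rw [← hc, ← hd, CFC.posPart_mul_negPart g]

/-- The Gram matrix of a finite family in a Hilbert module has the form `b⋆ b`. -/
lemma HilbertModule.exists_gram {X : HilbertModule.{u, v} A} {κ : Type} [Fintype κ] (x : κ → X) :
    ∃ b : κ → κ → A, ∀ i j, ip (x i) (x j) = ∑ k, star (b k i) * b k j := by
  classical
  let G : CStarMatrix κ κ A := CStarMatrix.ofMatrix (Matrix.of fun i j => ip (x i) (x j))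
  have hG : ∀ i j, G i j = ip (x i) (x j) := fun _ _ => rfl
  have hsa : IsSelfAdjoint G := by
    ext i j
    simp [CStarMatrix.star_apply, hG, star_ip]
  obtain ⟨c, d, hPN, hPN0⟩ := exists_posPart_negPart G hsa
  obtain ⟨N, hd⟩ : ∃ N, N = star d * d := ⟨_, rfl⟩
  rw [← hd] at hPN hPN0
  have hBsa : star N = N := by rw [hd, star_mul, star_star]
  have h1 : star N * G * N = -(star (d * N) * (d * N)) := by
    have : G * N = -(N * N) := by rw [hPN, sub_mul, hPN0, zero_sub]
    rw [star_mul, mul_assoc, this, hBsa, mul_assoc, ← mul_assoc (star d), ← hd, mul_neg]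
  have h2 : ∀ k, (star N * G * N) k k
      = ip (∑ i, ract (x i) (N i k)) (∑ i, ract (x i) (N i k)) := by
    intro k
    simp only [CStarMatrix.mul_apply, CStarMatrix.star_apply, ip_sum_left, ip_sum_right,
      ip_ract_left, ip_ract_right, hG, Finset.sum_mul, mul_assoc]
  have h3 : ∀ k, (star (d * N) * (d * N)) k k = ∑ i, star ((d * N) i k) * (d * N) i k := by
    intro k
    simp only [CStarMatrix.mul_apply, CStarMatrix.star_apply]
  have h4 : d * N = 0 := by
    ext i k
    have e : ∑ i, star ((d * N) i k) * (d * N) i k = 0 := by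
      refine le_antisymm ?_ (Finset.sum_nonneg fun i _ => star_mul_self_nonneg _)
      have := ip_self_nonneg (∑ i, ract (x i) (N i k))
      rw [← h2, h1, CStarMatrix.neg_apply, h3] at this
      exact neg_nonneg.mp this
    have := (Finset.sum_eq_zero_iff_of_nonneg
      (fun i _ => star_mul_self_nonneg ((d * N) i k))).mp e i (Finset.mem_univ _)
    simpa using (CStarRing.star_mul_self_eq_zero_iff _).mp this
  have h5 : N = 0 := by
    rw [← CStarRing.star_mul_self_eq_zero_iff, hBsa]
    nth_rewrite 1 [hd]
    rw [mul_assoc, h4, mul_zero]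
  have hc : G = star c * c := by rw [hPN, h5, sub_zero]
  refine ⟨fun i j => c i j, fun i j => ?_⟩
  rw [← hG, hc]
  simp only [CStarMatrix.mul_apply, CStarMatrix.star_apply]

end Gram

/-- An `A`-valued semi-inner product on a complex vector space with a right action of `A`. -/
structure PreHilbert (A : Type u) [NonUnitalCStarAlgebra A] [PartialOrder A]
    (E : Type v) [AddCommGroup E] [Module ℂ E] where
  form : E → E → A
  act : A → E →ₗ[ℂ] E
  form_add_right : ∀ x y z, form x (y + z) = form x y + form x z
  form_smul_right : ∀ (c : ℂ) x y, form x (c • y) = c • form x y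
  star_form : ∀ x y, star (form x y) = form y x
  form_self_nonneg : ∀ x, 0 ≤ form x x
  form_act : ∀ a x y, form x (act a y) = form x y * a

namespace PreHilbert

variable {A : Type u} [NonUnitalCStarAlgebra A] [PartialOrder A]
  {E : Type v} [AddCommGroup E] [Module ℂ E] (P : PreHilbert A E)

lemma form_add_left (x y z : E) : P.form (x + y) z = P.form x z + P.form y z := by
  rw [← P.star_form, P.form_add_right, star_add, P.star_form, P.star_form]

lemma form_smul_left (c : ℂ) (x y : E) : P.form (c • x) y = star c • P.form x y := by
  rw [← P.star_form, P.form_smul_right, star_smul, P.star_form]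

lemma form_act_left (a : A) (x y : E) : P.form (P.act a x) y = star a * P.form x y := by
  rw [← P.star_form, P.form_act, star_mul, P.star_form]

lemma form_neg_right (x y : E) : P.form x (-y) = -P.form x y := by
  rw [← neg_one_smul ℂ y, P.form_smul_right, neg_one_smul]

lemma form_sub_right (x y z : E) : P.form x (y - z) = P.form x y - P.form x z := by
  rw [sub_eq_add_neg, P.form_add_right, P.form_neg_right, sub_eq_add_neg]

lemma form_sub_left (x y z : E) : P.form (x - y) z = P.form x z - P.form y z := by
  rw [← P.star_form, P.form_sub_right, star_sub, P.star_form, P.star_form]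

lemma form_zero_right (x : E) : P.form x 0 = 0 := by
  have := P.form_smul_right 0 x 0
  simpa using this

lemma form_zero_left (x : E) : P.form 0 x = 0 := by
  rw [← P.star_form, P.form_zero_right, star_zero]

/-- The seminorm `‖⟨x, x⟩‖^{1/2}`. -/
def nrm (x : E) : ℝ := √‖P.form x x‖

lemma nrm_sq (x : E) : P.nrm x ^ 2 = ‖P.form x x‖ := Real.sq_sqrt (norm_nonneg _)

lemma nrm_nonneg (x : E) : 0 ≤ P.nrm x := Real.sqrt_nonneg _

lemma nrm_smul (c : ℂ) (x : E) : P.nrm (c • x) = ‖c‖ * P.nrm x := by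
  rw [nrm, nrm, form_smul_left, form_smul_right, norm_smul, norm_smul, norm_star,
    ← mul_assoc, Real.sqrt_mul (by positivity), Real.sqrt_mul_self (norm_nonneg _)]

lemma nrm_act (a : A) (x : E) : P.nrm (P.act a x) ≤ ‖a‖ * P.nrm x := by
  refine le_of_sq_le_sq ?_ (mul_nonneg (norm_nonneg _) (P.nrm_nonneg x))
  rw [mul_pow, nrm_sq, nrm_sq, form_act, form_act_left]
  calc ‖star a * P.form x x * a‖ ≤ ‖star a‖ * ‖P.form x x‖ * ‖a‖ :=
        (norm_mul_le _ _).trans (mul_le_mul_of_nonneg_right (norm_mul_le _ _) (norm_nonneg _))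
    _ = ‖a‖ ^ 2 * ‖P.form x x‖ := by rw [norm_star]; ring

/-- A copy of `E`, to carry the seminorm. -/
def Space (_P : PreHilbert A E) : Type v := E

instance : AddCommGroup P.Space :=
  inferInstanceAs (AddCommGroup E)

instance : Module ℂ P.Space :=
  inferInstanceAs (Module ℂ E)

instance : Norm P.Space :=
  ⟨P.nrm⟩

/-- The identity map of `E` as a map into the seminormed copy. -/
def toSpace : E ≃ₗ[ℂ] P.Space :=
  LinearEquiv.refl ℂ E

variable [StarOrderedRing A]

/-- The Cauchy–Schwarz inequality for the semi-inner product. -/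
lemma norm_form_le (x y : E) : ‖P.form x y‖ ≤ √‖P.form x x‖ * √‖P.form y y‖ := by
  have key : ∀ c : ℝ, ‖P.form x x‖ < c → ‖P.form x y‖ ^ 2 ≤ c * ‖P.form y y‖ := by
    intro c hc
    have hc0 : 0 < c := (norm_nonneg _).trans_lt hc
    have h1 : P.form y x * P.form x y ≤ c • P.form y y := by
      have h := P.form_self_nonneg (P.act (P.form x y) x - (c : ℂ) • y)
      simp only [form_sub_left, form_sub_right, form_smul_left, form_smul_right, form_act,
        form_act_left, P.star_form] at h
      have h2 : P.form y x * P.form x x * P.form x y ≤ c • (P.form y x * P.form x y) := by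
        have h3 : star (P.form x y) * P.form x x * P.form x y
            ≤ ‖P.form x x‖ • (star (P.form x y) * P.form x y) :=
          CStarAlgebra.star_left_conjugate_le_norm_smul
            (hb := (IsSelfAdjoint.of_nonneg (P.form_self_nonneg x)))
        rw [P.star_form] at h3
        refine h3.trans ?_
        have h4 : 0 ≤ P.form y x * P.form x y := by
          rw [← P.star_form x y]; exact star_mul_self_nonneg _
        exact smul_le_smul_of_nonneg_right hc.le h4
      have h5 : 0 ≤ c • (c • P.form y y - P.form y x * P.form x y) := by
        have e1 : ∀ z : A, (c : ℂ) • z = c • z := fun z => Complex.coe_smul c z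
        have e2 : star (c : ℂ) = (c : ℂ) := Complex.conj_ofReal c
        rw [e2] at h
        simp only [e1] at h
        refine h.trans ?_
        rw [← sub_nonneg] at h2 ⊢
        convert h2 using 1
        simp only [smul_sub, mul_assoc, sub_mul, smul_mul_assoc]
        abel
      have h6 := smul_nonneg (inv_nonneg.mpr hc0.le) h5
      rw [smul_smul, inv_mul_cancel₀ hc0.ne', one_smul, sub_nonneg] at h6
      exact h6
    have h4 : 0 ≤ P.form y x * P.form x y := by
      rw [← P.star_form x y]; exact star_mul_self_nonneg _
    have h7 := CStarAlgebra.norm_le_norm_of_nonneg_of_le h4 h1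
    rw [← P.star_form x y, CStarRing.norm_star_mul_self, norm_smul, Real.norm_of_nonneg hc0.le] at h7
    rwa [pow_two]
  have h8 : ‖P.form x y‖ ^ 2 ≤ ‖P.form x x‖ * ‖P.form y y‖ := by
    refine ge_of_tendsto (x := nhdsWithin ‖P.form x x‖ (Set.Ioi ‖P.form x x‖))
      (f := fun c : ℝ => c * ‖P.form y y‖) ?_ ?_
    · exact tendsto_nhdsWithin_of_tendsto_nhds
        ((continuous_id.mul continuous_const).tendsto _)
    · filter_upwards [self_mem_nhdsWithin] with c hc using key c hc
  rw [← Real.sqrt_mul (norm_nonneg _)]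
  exact Real.le_sqrt_of_sq_le h8

lemma nrm_add (x y : E) : P.nrm (x + y) ≤ P.nrm x + P.nrm y := by
  refine le_of_sq_le_sq ?_ (add_nonneg (P.nrm_nonneg x) (P.nrm_nonneg y))
  have h2 : P.form (x + y) (x + y)
      = P.form x x + P.form x y + (P.form y x + P.form y y) := by
    rw [form_add_left, form_add_right, form_add_right]
  have h3 : ‖P.form x y‖ ≤ P.nrm x * P.nrm y := P.norm_form_le x y
  have h4 : ‖P.form y x‖ ≤ P.nrm y * P.nrm x := P.norm_form_le y x
  calc P.nrm (x + y) ^ 2 = ‖P.form x x + P.form x y + (P.form y x + P.form y y)‖ := by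
        rw [nrm_sq, ← h2]
    _ ≤ ‖P.form x x‖ + ‖P.form x y‖ + (‖P.form y x‖ + ‖P.form y y‖) :=
        (norm_add_le _ _).trans (add_le_add (norm_add_le _ _) (norm_add_le _ _))
    _ ≤ (P.nrm x + P.nrm y) ^ 2 := by rw [← nrm_sq, ← nrm_sq]; nlinarith

lemma core : SeminormedSpace.Core ℂ P.Space where
  norm_nonneg x := P.nrm_nonneg x
  norm_smul c x := P.nrm_smul c x
  norm_triangle x y := P.nrm_add x y

instance : SeminormedAddCommGroup P.Space := SeminormedAddCommGroup.ofCore P.core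
instance : NormedSpace ℂ P.Space where
  norm_smul_le c x := (P.nrm_smul c x).le

/-- The right action of `a` on the seminormed space. -/
def actL (a : A) : P.Space →L[ℂ] P.Space :=
  LinearMap.mkContinuous (P.act a : P.Space →ₗ[ℂ] P.Space) ‖a‖ fun x => P.nrm_act a x

instance : Inner Aᵐᵒᵖ P.Space := ⟨fun x y => op (P.form x y)⟩

lemma continuous_inner : Continuous fun p : P.Space × P.Space => inner Aᵐᵒᵖ p.1 p.2 := by
  let F : P.Space →L⋆[ℂ] P.Space →L[ℂ] A :=
    LinearMap.mkContinuous₂ (LinearMap.mk₂'ₛₗ (starRingEnd ℂ) (RingHom.id ℂ)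
      (fun x y : P.Space => P.form x y) (fun x y z => P.form_add_left x y z)
      (fun c x y => P.form_smul_left c x y) (fun x y z => P.form_add_right x y z)
      (fun c x y => P.form_smul_right c x y)) 1 (fun x y => by
        rw [one_mul]; exact P.norm_form_le x y)
  have : Continuous fun p : P.Space × P.Space => F p.1 p.2 := by fun_prop
  exact continuous_op.comp this

/-- The completion of the seminormed space (which also divides out the vectors of length zero). -/
abbrev Compl : Type v := UniformSpace.Completion P.Space

open UniformSpace

lemma inner_coe (x y : P.Space) :
    inner Aᵐᵒᵖ (x : P.Compl) (y : P.Compl) = op (P.form x y) :=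
  (Completion.isDenseInducing_coe.prodMap Completion.isDenseInducing_coe).extend_eq
    P.continuous_inner (x, y)

lemma continuous_inner_compl :
    Continuous fun p : P.Compl × P.Compl => inner Aᵐᵒᵖ p.1 p.2 := by
  let inner' : P.Space →+ P.Space →+ Aᵐᵒᵖ :=
    { toFun := fun x =>
        { toFun := fun y => inner Aᵐᵒᵖ x y
          map_zero' := congrArg op (P.form_zero_right x)
          map_add' := fun y z => congrArg op (P.form_add_right x y z) }
      map_zero' := by
        ext y
        exact congrArg op (P.form_zero_left y)
      map_add' := fun x y => by ext z; exact congrArg op (P.form_add_left x y z) }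
  have : Continuous fun p : P.Space × P.Space => inner' p.1 p.2 := P.continuous_inner
  exact (Completion.isDenseInducing_toCompl P.Space).extend_Z_bilin
    (Completion.isDenseInducing_toCompl P.Space) this

lemma continuous_inner_compl' {Z : Type*} [TopologicalSpace Z] {f g : Z → P.Compl}
    (hf : Continuous f) (hg : Continuous g) : Continuous fun z => inner Aᵐᵒᵖ (f z) (g z) :=
  P.continuous_inner_compl.comp (hf.prodMk hg)

instance : SMul Aᵐᵒᵖ P.Compl := ⟨fun a x => Completion.map (P.actL (unop a)) x⟩

lemma op_smul_coe (a : A) (x : P.Space) : op a • (x : P.Compl) = ((P.actL a x : P.Space) : P.Compl) :=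
  Completion.map_coe (P.actL a).uniformContinuous x

lemma continuous_op_smul (a : Aᵐᵒᵖ) : Continuous fun x : P.Compl => a • x :=
  Completion.continuous_map

lemma norm_compl (x : P.Compl) : ‖x‖ = √‖inner Aᵐᵒᵖ x x‖ := by
  induction x using Completion.induction_on with
  | hp =>
    exact isClosed_eq continuous_norm (Real.continuous_sqrt.comp (continuous_norm.comp
        (P.continuous_inner_compl' continuous_id continuous_id)))
  | ih x =>
    rw [Completion.norm_coe, inner_coe]
    rfl

instance : CStarModule Aᵐᵒᵖ P.Compl where
  inner_add_right {x y z} := by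
    induction x, y, z using Completion.induction_on₃ with
    | hp =>
      exact isClosed_eq (P.continuous_inner_compl' (by fun_prop) (by fun_prop))
        ((P.continuous_inner_compl' (by fun_prop) (by fun_prop)).add
          (P.continuous_inner_compl' (by fun_prop) (by fun_prop)))
    | ih x y z =>
      rw [← Completion.coe_add, inner_coe, inner_coe, inner_coe]
      exact congrArg op (P.form_add_right x y z)
  inner_self_nonneg {x} := by
    induction x using Completion.induction_on with
    | hp =>
      exact isClosed_Ici.preimage (P.continuous_inner_compl' continuous_id continuous_id)
    | ih x => rw [inner_coe]; exact P.form_self_nonneg x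
  inner_self {x} := by
    rw [← norm_eq_zero (a := x), P.norm_compl x, Real.sqrt_eq_zero (norm_nonneg _), norm_eq_zero]
  inner_op_smul_right {a x y} := by
    induction x, y using Completion.induction_on₂ with
    | hp =>
      exact isClosed_eq (P.continuous_inner_compl' (by fun_prop)
          ((P.continuous_op_smul a).comp (by fun_prop)))
        (continuous_const.mul (P.continuous_inner_compl' (by fun_prop) (by fun_prop)))
    | ih x y =>
      rw [← op_unop a, op_smul_coe, inner_coe, inner_coe]
      exact congrArg op (P.form_act (unop a) x y)
  inner_smul_right_complex {c x y} := by
    induction x, y using Completion.induction_on₂ with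
    | hp =>
      exact isClosed_eq
        (P.continuous_inner_compl' continuous_fst (continuous_snd.const_smul c))
        ((P.continuous_inner_compl' continuous_fst continuous_snd).const_smul c)
    | ih x y =>
      rw [← Completion.coe_smul, inner_coe, inner_coe]
      exact congrArg op (P.form_smul_right c x y)
  star_inner x y := by
    induction x, y using Completion.induction_on₂ with
    | hp =>
      exact isClosed_eq (P.continuous_inner_compl' (by fun_prop) (by fun_prop)).star
        (P.continuous_inner_compl' (by fun_prop) (by fun_prop))
    | ih x y =>
      rw [inner_coe, inner_coe]
      exact congrArg op (P.star_form x y)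
  norm_eq_sqrt_norm_inner_self x := P.norm_compl x

/-- The Hilbert `A`-module obtained by completing a semi-inner product `A`-module. -/
def completion : HilbertModule.{u, v} A where
  carrier := P.Compl

end PreHilbert

section Tensor

variable {A : Type u} [NonUnitalCStarAlgebra A] [PartialOrder A]

/-- The sesquilinear form on the algebraic tensor product `X ⊙ M` with
`⟨x ⊗ m, y ⊗ n⟩ = ⟨m, ⟨x, y⟩ · n⟩ = ⟨⟨y, x⟩ · m, n⟩`. -/
def tensorForm (X : HilbertModule.{u, v} A) (M : Correspondence.{u, v} A) :
    (X ⊗[ℂ] M.carrier) →ₗ⋆[ℂ] (X ⊗[ℂ] M.carrier) →ₗ[ℂ] A :=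
  TensorProduct.lift (LinearMap.mk₂'ₛₗ (starRingEnd ℂ) (starRingEnd ℂ)
    (fun x m => TensorProduct.lift (LinearMap.mk₂ ℂ
      (fun y n => ip (X := M.toHilbertModule) m (M.left (ip x y) n))
      (fun y y' n => by simp only [ip_add_right, map_add, add_apply])
      (fun c y n => by simp only [ip_smul_right, map_smul, smul_apply])
      (fun y n n' => by simp only [map_add, ip_add_right])
      (fun c y n => by simp only [map_smul, ip_smul_right])))
    (fun x x' m => TensorProduct.ext' fun y n => by
      simp [ip_add_left, ip_add_right])
    (fun c x m => TensorProduct.ext' fun y n => by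
      simp [ip_smul_left, ip_smul_right])
    (fun x m m' => TensorProduct.ext' fun y n => by
      simp [ip_add_left])
    (fun c x m => TensorProduct.ext' fun y n => by
      simp [ip_smul_left]))

lemma tensorForm_tmul (X : HilbertModule.{u, v} A) (M : Correspondence.{u, v} A)
    (x y : X) (m n : M.carrier) :
    tensorForm X M (x ⊗ₜ m) (y ⊗ₜ n) = ip (X := M.toHilbertModule) m (M.left (ip x y) n) := rfl

/-- The right action of `a` on a Hilbert module as a complex-linear map. -/
def ractₗ (X : HilbertModule.{u, v} A) (a : A) : X →ₗ[ℂ] X where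
  toFun x := ract x a
  map_add' x y := ract_add x y a
  map_smul' c x := ract_smul c x a

variable [StarOrderedRing A]

/-- The algebraic tensor product `X ⊙ M` as a semi-inner product module. -/
def preTensor (X : HilbertModule.{u, v} A) (M : Correspondence.{u, v} A) :
    PreHilbert A (X ⊗[ℂ] M.carrier) where
  form s t := tensorForm X M s t
  act a := LinearMap.lTensor X (ractₗ M.toHilbertModule a)
  form_add_right s t t' := map_add _ _ _
  form_smul_right c s t := map_smul _ _ _
  star_form s t := by
    induction s using TensorProduct.induction_on with
    | zero => simp
    | add s s' hs hs' => simp only [map_add, LinearMap.add_apply, star_add, hs, hs']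
    | tmul x m =>
      induction t using TensorProduct.induction_on with
      | zero => simp
      | add t t' ht ht' => simp only [map_add, LinearMap.add_apply, star_add, ht, ht']
      | tmul y n => rw [tensorForm_tmul, tensorForm_tmul, star_ip, M.ip_left, star_ip]
  form_self_nonneg t := by
    obtain ⟨N, x, m, rfl⟩ : ∃ (N : ℕ) (x : Fin N → X) (m : Fin N → M.carrier),
        t = ∑ i, x i ⊗ₜ[ℂ] m i := by
      obtain ⟨S, rfl⟩ := TensorProduct.exists_finset t
      refine ⟨S.card, fun i => (S.equivFin.symm i).1.1, fun i => (S.equivFin.symm i).1.2, ?_⟩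
      rw [Equiv.sum_comp S.equivFin.symm (fun p : S => p.1.1 ⊗ₜ[ℂ] p.1.2),
        Finset.sum_coe_sort S (fun p => p.1 ⊗ₜ[ℂ] p.2)]
    obtain ⟨b, hb⟩ := exists_gram x
    have : tensorForm X M (∑ i, x i ⊗ₜ[ℂ] m i) (∑ i, x i ⊗ₜ[ℂ] m i)
        = ∑ k, ip (X := M.toHilbertModule) (∑ i, M.left (b k i) (m i))
            (∑ j, M.left (b k j) (m j)) := by
      simp only [map_sum, LinearMap.sum_apply, tensorForm_tmul, hb, ip_sum_left, ip_sum_right,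
        M.ip_left, map_mul, sum_apply, mul_apply_eq_comp]
      refine (Finset.sum_congr rfl fun _ _ => Finset.sum_comm).trans ?_
      rw [Finset.sum_comm]
    rw [this]
    exact Finset.sum_nonneg fun k _ => ip_self_nonneg _
  form_act a s t := by
    induction s using TensorProduct.induction_on with
    | zero => simp
    | add s s' hs hs' => simp only [map_add, LinearMap.add_apply, add_mul, hs, hs']
    | tmul x m =>
      induction t using TensorProduct.induction_on with
      | zero => simp
      | add t t' ht ht' => simp only [map_add, add_mul, ht, ht']
      | tmul y n =>
        have h : ∀ (c : A) (n : M.carrier),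
            ip (X := M.toHilbertModule) m (M.left c n)
              = ip (X := M.toHilbertModule) (M.left (star c) m) n := fun c n => by
          rw [M.ip_left, star_star]
        rw [LinearMap.lTensor_tmul, tensorForm_tmul, tensorForm_tmul, h, h]
        exact ip_ract_right _ _ _

/-- The internal tensor product `X ⊗_A M`: the completion of the algebraic tensor product. -/
def HilbertModule.tensor (X : HilbertModule.{u, v} A) (M : Correspondence.{u, v} A) :
    HilbertModule.{u, v} A :=
  (preTensor X M).completion

/-- The image of the algebraic tensor product in `X ⊗_A M`. -/
def algToTensor (X : HilbertModule.{u, v} A) (M : Correspondence.{u, v} A)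
    (t : X ⊗[ℂ] M.carrier) : X.tensor M :=
  (((preTensor X M).toSpace t : (preTensor X M).Space) : (preTensor X M).Compl)

/-- The elementary tensor `x ⊗ m` in `X ⊗_A M`. -/
def tmul {X : HilbertModule.{u, v} A} {M : Correspondence.{u, v} A} (x : X) (m : M.carrier) :
    X.tensor M :=
  algToTensor X M (x ⊗ₜ[ℂ] m)

lemma ip_algToTensor (X : HilbertModule.{u, v} A) (M : Correspondence.{u, v} A)
    (s t : X ⊗[ℂ] M.carrier) :
    ip (algToTensor X M s) (algToTensor X M t) = tensorForm X M s t :=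
  congrArg unop ((preTensor X M).inner_coe _ _)

lemma ip_tmul {X : HilbertModule.{u, v} A} {M : Correspondence.{u, v} A} (x y : X)
    (m n : M.carrier) :
    ip (tmul x m) (tmul y n) = ip (X := M.toHilbertModule) (M.left (ip y x) m) n := by
  rw [tmul, tmul, ip_algToTensor, tensorForm_tmul, M.ip_left, star_ip]

lemma tensor_induction {X : HilbertModule.{u, v} A} {M : Correspondence.{u, v} A}
    (p : X.tensor M → Prop) (hp : IsClosed {z | p z})
    (h : ∀ t, p (algToTensor X M t)) (z : X.tensor M) : p z :=
  UniformSpace.Completion.induction_on (α := (preTensor X M).Space) z hp h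

lemma algToTensor_add {X : HilbertModule.{u, v} A} {M : Correspondence.{u, v} A}
    (s t : X ⊗[ℂ] M.carrier) :
    algToTensor X M (s + t) = algToTensor X M s + algToTensor X M t :=
  UniformSpace.Completion.coe_add (α := (preTensor X M).Space) _ _

lemma algToTensor_smul {X : HilbertModule.{u, v} A} {M : Correspondence.{u, v} A}
    (c : ℂ) (t : X ⊗[ℂ] M.carrier) :
    algToTensor X M (c • t) = c • algToTensor X M t :=
  UniformSpace.Completion.coe_smul c ((preTensor X M).toSpace t)

lemma HilbertModule.continuous_ip {X : HilbertModule.{u, v} A} :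
    Continuous fun p : X × X => ip p.1 p.2 :=
  continuous_unop.comp (CStarModule.continuous_inner (A := Aᵐᵒᵖ) (E := X))

end Tensor

section Maps

variable {A : Type u} [NonUnitalCStarAlgebra A] [PartialOrder A]

/-- Inner-product preserving maps of Hilbert modules (they are automatically `A`-linear). -/
structure IPMap (X Y : HilbertModule.{u, v} A) extends X.carrier →ₗ[ℂ] Y.carrier where
  ip_map : ∀ x y : X, ip (toLinearMap x) (toLinearMap y) = ip x y

instance (X Y : HilbertModule.{u, v} A) : CoeFun (IPMap X Y) (fun _ => X → Y) :=
  ⟨fun S => S.toLinearMap⟩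

/-- Isomorphisms of Hilbert modules. -/
structure HilbertIso (X Y : HilbertModule.{u, v} A) extends X.carrier ≃ₗ[ℂ] Y.carrier where
  ip_map : ∀ x y : X, ip (toLinearEquiv x) (toLinearEquiv y) = ip x y

instance (X Y : HilbertModule.{u, v} A) : CoeFun (HilbertIso X Y) (fun _ => X → Y) :=
  ⟨fun S => S.toLinearEquiv⟩

namespace IPMap

variable {X Y Z : HilbertModule.{u, v} A}

/-- Existence of an adjoint map. -/
def IsAdjointable (S : IPMap X Y) : Prop :=
  ∃ S' : Y → X, ∀ (x : X) (y : Y), ip (S x) y = ip x (S' y)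

/-- The range, as a complex subspace. -/
def range (S : IPMap X Y) : Submodule ℂ Y := LinearMap.range S.toLinearMap

lemma map_ract (S : IPMap X Y) (x : X) (a : A) : S (ract x a) = ract (S x) a := by
  rw [← sub_eq_zero, ← ip_self_eq_zero]
  simp only [ip_sub_left, ip_sub_right, ip_ract_left, ip_ract_right, S.ip_map]
  simp [mul_assoc]

lemma norm_map (S : IPMap X Y) (x : X) : ‖S x‖ = ‖x‖ := by
  rw [norm_eq, norm_eq, S.ip_map]

lemma isometry (S : IPMap X Y) : Isometry S :=
  AddMonoidHomClass.isometry_of_norm S.toLinearMap S.norm_map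

lemma tensorForm_rTensor (S : IPMap X Y) (M : Correspondence.{u, v} A) (s t : X ⊗[ℂ] M.carrier) :
    tensorForm Y M (S.toLinearMap.rTensor M.carrier s) (S.toLinearMap.rTensor M.carrier t)
      = tensorForm X M s t := by
  induction s using TensorProduct.induction_on with
  | zero => simp
  | add s s' hs hs' => simp only [map_add, LinearMap.add_apply, hs, hs']
  | tmul x m =>
    induction t using TensorProduct.induction_on with
    | zero => simp
    | add t t' ht ht' => simp only [map_add, ht, ht']
    | tmul y n =>
      rw [LinearMap.rTensor_tmul, LinearMap.rTensor_tmul, tensorForm_tmul, tensorForm_tmul,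
        S.ip_map]

variable [StarOrderedRing A]

/-- `S ⊗ id` on the seminormed algebraic tensor products. -/
def preTensorId (S : IPMap X Y) (M : Correspondence.{u, v} A) :
    (preTensor X M).Space →ₗᵢ[ℂ] (preTensor Y M).Space where
  toLinearMap := (S.toLinearMap.rTensor M.carrier : X ⊗[ℂ] M.carrier →ₗ[ℂ] Y ⊗[ℂ] M.carrier)
  norm_map' t := congrArg (fun a : A => √‖a‖) (S.tensorForm_rTensor M t t)

/-- The continuous extension of `S ⊗ id` to the completions. -/
def tensorIdFun (S : IPMap X Y) (M : Correspondence.{u, v} A) : X.tensor M → Y.tensor M :=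
  UniformSpace.Completion.map (S.preTensorId M)

lemma tensorIdFun_alg (S : IPMap X Y) (M : Correspondence.{u, v} A) (t : X ⊗[ℂ] M.carrier) :
    S.tensorIdFun M (algToTensor X M t)
      = algToTensor Y M (S.toLinearMap.rTensor M.carrier t) :=
  UniformSpace.Completion.map_coe (S.preTensorId M).isometry.uniformContinuous _

lemma continuous_tensorIdFun (S : IPMap X Y) (M : Correspondence.{u, v} A) :
    Continuous (S.tensorIdFun M) :=
  UniformSpace.Completion.continuous_map

/-- The inner-product preserving map `S ⊗ id : X ⊗_A M → Y ⊗_A M`. -/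
def tensorId (S : IPMap X Y) (M : Correspondence.{u, v} A) : IPMap (X.tensor M) (Y.tensor M) where
  toFun := S.tensorIdFun M
  map_add' z w := by
    have hc := S.continuous_tensorIdFun M
    refine tensor_induction (fun z => S.tensorIdFun M (z + w)
      = S.tensorIdFun M z + S.tensorIdFun M w) (isClosed_eq (by fun_prop) (by fun_prop))
      (fun s => ?_) z
    refine tensor_induction (fun w => S.tensorIdFun M (algToTensor X M s + w)
      = S.tensorIdFun M (algToTensor X M s) + S.tensorIdFun M w)
      (isClosed_eq (by fun_prop) (by fun_prop)) (fun t => ?_) w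
    simp only [← algToTensor_add, tensorIdFun_alg, map_add]
  map_smul' c z := by
    have hc := S.continuous_tensorIdFun M
    refine tensor_induction (fun z => S.tensorIdFun M (c • z) = c • S.tensorIdFun M z)
      (isClosed_eq (hc.comp (continuous_const_smul c)) (hc.const_smul c)) (fun s => ?_) z
    rw [← algToTensor_smul, tensorIdFun_alg, tensorIdFun_alg, map_smul, algToTensor_smul]
  ip_map z w := by
    have hc := S.continuous_tensorIdFun M
    refine tensor_induction (fun z => ip (S.tensorIdFun M z) (S.tensorIdFun M w) = ip z w)
      (isClosed_eq (continuous_ip.comp (hc.prodMk continuous_const))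
        (continuous_ip.comp (continuous_id.prodMk continuous_const))) (fun s => ?_) z
    refine tensor_induction (fun w => ip (S.tensorIdFun M (algToTensor X M s))
      (S.tensorIdFun M w) = ip (algToTensor X M s) w)
      (isClosed_eq (continuous_ip.comp (continuous_const.prodMk hc))
        (continuous_ip.comp (continuous_const.prodMk continuous_id))) (fun t => ?_) w
    rw [tensorIdFun_alg, tensorIdFun_alg, ip_algToTensor, ip_algToTensor, tensorForm_rTensor]

lemma tensorId_tmul (S : IPMap X Y) (M : Correspondence.{u, v} A) (x : X) (m : M.carrier) :
    S.tensorId M (tmul x m) = tmul (S x) m :=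
  S.tensorIdFun_alg M (x ⊗ₜ[ℂ] m)

lemma tensorId_leftInverse (S : IPMap X Y) (S' : IPMap Y X) (h : ∀ x, S' (S x) = x)
    (M : Correspondence.{u, v} A) (z : X.tensor M) : S'.tensorId M (S.tensorId M z) = z := by
  have hS := S.continuous_tensorIdFun M
  have hS' := S'.continuous_tensorIdFun M
  refine tensor_induction (fun z => S'.tensorIdFun M (S.tensorIdFun M z) = z)
    (isClosed_eq (hS'.comp hS) continuous_id) (fun t => ?_) z
  rw [tensorIdFun_alg, tensorIdFun_alg, ← LinearMap.rTensor_comp_apply]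
  have : S'.toLinearMap ∘ₗ S.toLinearMap = LinearMap.id := LinearMap.ext h
  rw [this, LinearMap.rTensor_id, LinearMap.id_apply]

end IPMap

namespace HilbertIso

variable {X Y Z : HilbertModule.{u, v} A}

/-- An isomorphism as an inner-product preserving map. -/
def toIPMap (U : HilbertIso X Y) : IPMap X Y where
  toLinearMap := U.toLinearEquiv
  ip_map := U.ip_map

/-- The inverse isomorphism. -/
def symm (U : HilbertIso X Y) : HilbertIso Y X where
  toLinearEquiv := U.toLinearEquiv.symm
  ip_map x y := by
    rw [← U.ip_map]
    simp

/-- The identity. -/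
def refl (X : HilbertModule.{u, v} A) : HilbertIso X X where
  toLinearEquiv := LinearEquiv.refl ℂ X
  ip_map _ _ := rfl

/-- The composition `V ∘ U`. -/
def trans (U : HilbertIso X Y) (V : HilbertIso Y Z) : HilbertIso X Z where
  toLinearEquiv := U.toLinearEquiv.trans V.toLinearEquiv
  ip_map x y := (V.ip_map _ _).trans (U.ip_map x y)

variable [StarOrderedRing A]

/-- The isomorphism `U ⊗ id : X ⊗_A M → Y ⊗_A M`. -/
def tensorId (U : HilbertIso X Y) (M : Correspondence.{u, v} A) :
    HilbertIso (X.tensor M) (Y.tensor M) where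
  toLinearEquiv := LinearEquiv.ofLinearMap (U.toIPMap.tensorId M).toLinearMap
    (U.symm.toIPMap.tensorId M).toLinearMap
    (LinearMap.ext fun z => U.symm.toIPMap.tensorId_leftInverse U.toIPMap
      (fun y => U.toLinearEquiv.apply_symm_apply y) M z)
    (LinearMap.ext fun z => U.toIPMap.tensorId_leftInverse U.symm.toIPMap
      (fun x => U.toLinearEquiv.symm_apply_apply x) M z)
  ip_map := (U.toIPMap.tensorId M).ip_map

end HilbertIso

end Maps

section Powers

variable {A : Type u} [NonUnitalCStarAlgebra A] [PartialOrder A] [StarOrderedRing A]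

/-- `X ⊗_A M^{⊗ k}`, bracketed as `((X ⊗_A M) ⊗_A M) ⊗_A ⋯ ⊗_A M`; it is `X` for `k = 0`. -/
def HilbertModule.tpow (X : HilbertModule.{u, v} A) (M : Correspondence.{u, v} A) :
    ℕ → HilbertModule.{u, v} A
  | 0 => X
  | k + 1 => (X.tpow M k).tensor M

/-- `S ⊗ id_k : X ⊗_A M^{⊗ k} → Y ⊗_A M^{⊗ k}`. -/
def IPMap.tpow {X Y : HilbertModule.{u, v} A} (S : IPMap X Y) (M : Correspondence.{u, v} A) :
    (k : ℕ) → IPMap (X.tpow M k) (Y.tpow M k)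
  | 0 => S
  | k + 1 => (S.tpow M k).tensorId M

/-- For `T : X → X ⊗_A M`, the map `T ⊗ id_k : X ⊗_A M^{⊗ k} → X ⊗_A M^{⊗ (k + 1)}`. -/
def IPMap.amp {M : Correspondence.{u, v} A} {X : HilbertModule.{u, v} A}
    (T : IPMap X (X.tensor M)) : (k : ℕ) → IPMap (X.tpow M k) (X.tpow M (k + 1))
  | 0 => T
  | k + 1 => (T.amp k).tensorId M

/-- For an isomorphism `U : X → X ⊗_A M`, the isomorphism
`U ⊗ id_k : X ⊗_A M^{⊗ k} → X ⊗_A M^{⊗ (k + 1)}`. -/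
def HilbertIso.amp {M : Correspondence.{u, v} A} {X : HilbertModule.{u, v} A}
    (U : HilbertIso X (X.tensor M)) : (k : ℕ) → HilbertIso (X.tpow M k) (X.tpow M (k + 1))
  | 0 => U
  | k + 1 => (U.amp k).tensorId M

/-- The isomorphisms `U^k : X → X ⊗_A M^{⊗ k}`, with `U^0 = id` and
`U^{k+1} = (U ⊗ id_k) ∘ U^k`. -/
def HilbertIso.pow {M : Correspondence.{u, v} A} {X : HilbertModule.{u, v} A}
    (U : HilbertIso X (X.tensor M)) : (k : ℕ) → HilbertIso X (X.tpow M k)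
  | 0 => HilbertIso.refl X
  | k + 1 => (U.pow k).trans (U.amp k)

/-- For a closed submodule `V` of `X`, the submodule `V ⊗_A M^{⊗ k}` of `X ⊗_A M^{⊗ k}`: in each
step the closed linear span of the elementary tensors. -/
def HilbertModule.subTpow (X : HilbertModule.{u, v} A) (V : Submodule ℂ X)
    (M : Correspondence.{u, v} A) : (k : ℕ) → Submodule ℂ (X.tpow M k)
  | 0 => V
  | k + 1 => (Submodule.span ℂ
      {z : (X.tpow M k).tensor M | ∃ t ∈ X.subTpow V M k, ∃ m : M.carrier, z = tmul t m}
        ).topologicalClosure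

end Powers

section Limits

variable {A : Type u} [NonUnitalCStarAlgebra A] [PartialOrder A]

/-- Closed `A`-submodules of a Hilbert module. -/
structure IsClosedSubmodule {X : HilbertModule.{u, v} A} (V : Submodule ℂ X) : Prop where
  isClosed : IsClosed (V : Set X)
  ract_mem : ∀ x ∈ V, ∀ a : A, ract x a ∈ V

/-- The closed submodule `V` is contained and (orthogonally) complemented in the Hilbert module
`W`, where `W` is a closed submodule of `X`. -/
structure IsComplementedIn {X : HilbertModule.{u, v} A} (V W : Submodule ℂ X) : Prop where
  left : IsClosedSubmodule V
  right : IsClosedSubmodule W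
  le : V ≤ W
  exists_add : ∀ w ∈ W, ∃ v ∈ V, ∃ n ∈ W, (∀ v' ∈ V, ip v' n = 0) ∧ w = v + n

/-- `(L, ι)` is the direct limit of the system of Hilbert modules `X₀ → X₁ → X₂ → ⋯`: it has the
universal property for uniformly bounded compatible families of bounded module homomorphisms. -/
structure IsDirectLimit (X : ℕ → HilbertModule.{u, v} A) (T : ∀ k, IPMap (X k) (X (k + 1)))
    (L : HilbertModule.{u, v} A) (ι : ∀ k, IPMap (X k) L) : Prop where
  compat : ∀ (k : ℕ) (x : X k), ι (k + 1) (T k x) = ι k x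
  universal : ∀ (Z : HilbertModule.{u, v} A) (S : ∀ k, X k →L[ℂ] Z) (C : ℝ),
    (∀ (k : ℕ) (x : X k) (a : A), S k (ract x a) = ract (S k x) a) →
    (∀ (k : ℕ) (x : X k), S (k + 1) (T k x) = S k x) →
    (∀ k, ‖S k‖ ≤ C) →
    ∃! S' : L →L[ℂ] Z,
      (∀ (x : L) (a : A), S' (ract x a) = ract (S' x) a) ∧ ‖S'‖ ≤ C ∧
        ∀ (k : ℕ) (x : X k), S' (ι k x) = S k x

variable [StarOrderedRing A]

/-- `V₀, V₁, …` is a projective multi-resolution analysis for the closed submodule `W` of `X`,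
with respect to the isomorphism `U : X → X ⊗_A M`. -/
structure IsProjectiveMRA {M : Correspondence.{u, v} A} {X : HilbertModule.{u, v} A}
    (U : HilbertIso X (X.tensor M)) (W : Submodule ℂ X) (V : ℕ → Submodule ℂ X) : Prop where
  complemented_zero : IsComplementedIn (V 0) W
  eq_pow_symm : ∀ k,
    V k = (X.subTpow (V 0) M k).map ((U.pow k).symm.toLinearEquiv : X.tpow M k →ₗ[ℂ] X)
  complemented_succ : ∀ k, IsComplementedIn (V k) (V (k + 1))
  le : ∀ k, V k ≤ W
  dense : (W : Set X) ⊆ closure (⋃ k, (V k : Set X))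

end Limits

end

/-! The isomorphism `R` is the shift of the tower. Since `T_{k+1} = T_k ⊗ id`, tensoring the maps `ι
k` with the identity gives a compatible family again, moved by one index and with values in `Y_∞ ⊗
M`. The map it induces preserves inner products, and it is onto because its range is closed and
contains the tensors `ι^k(y) ⊗ m = R(ι^{k+1}(y ⊗ m))`, which span a dense subspace
(`IsDirectLimit.exists_iso`). Induction gives `R^k ∘ ι^k = ι^0 ⊗ id_k`, hence `Y_k = R^{-k}(Y_0 ⊗
M^{⊗k})`.

An isometry of Hilbert modules need not have complemented range; the complements come from the
adjoint of `T`. They are followed through the predicate `IPMap.Decomposes`. The vectors that have a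
projection to the range of an isometry form a closed set (`IPMap.isClosed_decomposes`), so existence
of projections passes from `T` to `T ⊗ id_k` (`IPMap.decomposes_tensorId`), and from there to the `ι
k` (`IsDirectLimit.decomposes`).

A direct limit is built as the completion of the eventually coherent sequences. An arbitrary one is
known only by its universal property; comparison with the concrete one shows that the images of the
stages are dense in it (`IsDirectLimit.induction`), so that identities may be checked at finite
stages.

In (b), `Q` is induced by the compatible maps `D^{-k} ∘ (Q_0 ⊗ id_k)`; being inner-product
preserving, it carries the whole analysis of (a) to `X`. -/

noncomputable section

open scoped TensorProduct
open MulOpposite HilbertModule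

/-! ### Inner-product preserving maps, projections and complements -/

section

variable {A : Type u} [NonUnitalCStarAlgebra A] [PartialOrder A]

namespace HilbertModule

variable {X : HilbertModule.{u, v} A}

lemma ip_zero_right (x : X) : ip x 0 = 0 := by simp [ip]

lemma ip_zero_left (x : X) : ip 0 x = 0 := by simp [ip]

lemma norm_ract_le (x : X) (a : A) : ‖ract x a‖ ≤ ‖x‖ * ‖a‖ := by
  refine le_of_sq_le_sq ?_ (by positivity)
  rw [mul_pow, norm_eq, norm_eq, Real.sq_sqrt (norm_nonneg _), Real.sq_sqrt (norm_nonneg _),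
    ip_ract_right, ip_ract_left]
  calc ‖star a * ip x x * a‖ ≤ ‖star a‖ * ‖ip x x‖ * ‖a‖ :=
        (norm_mul_le _ _).trans (mul_le_mul_of_nonneg_right (norm_mul_le _ _) (norm_nonneg _))
    _ = ‖ip x x‖ * ‖a‖ ^ 2 := by rw [norm_star]; ring

lemma continuous_ract (a : A) : Continuous fun x : X => ract x a :=
  (LinearMap.mkContinuous (ractₗ X a) ‖a‖ fun x => by
    rw [mul_comm]; exact norm_ract_le x a).continuous

end HilbertModule

namespace IPMap

variable {X Y Z : HilbertModule.{u, v} A}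

lemma ext_apply {S S' : IPMap X Y} (h : ∀ x, S x = S' x) : S = S' := by
  cases S; cases S'
  congr
  exact LinearMap.ext h

/-- The composition `S ∘ S'`. -/
def comp (S : IPMap Y Z) (S' : IPMap X Y) : IPMap X Z where
  toLinearMap := S.toLinearMap ∘ₗ S'.toLinearMap
  ip_map x y := (S.ip_map _ _).trans (S'.ip_map x y)

lemma comp_apply (S : IPMap Y Z) (S' : IPMap X Y) (x : X) : S.comp S' x = S (S' x) := rfl

/-- An inner-product preserving map as a linear isometry. -/
def toIsometry (S : IPMap X Y) : X →ₗᵢ[ℂ] Y where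
  toLinearMap := S.toLinearMap
  norm_map' := S.norm_map

lemma isClosedSubmodule_range (S : IPMap X Y) : IsClosedSubmodule S.range where
  isClosed := by
    have := S.isometry.isClosedEmbedding.isClosed_range
    rwa [← LinearMap.coe_range] at this
  ract_mem := by
    rintro _ ⟨x, rfl⟩ a
    exact ⟨ract x a, S.map_ract x a⟩

/-- The vector `y` has an orthogonal projection to the range of `S`. -/
def Decomposes (S : IPMap X Y) (y : Y) : Prop :=
  ∃ x, ∀ x', ip (S x') (y - S x) = 0

lemma decomposes_apply (S : IPMap X Y) (x : X) : S.Decomposes (S x) :=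
  ⟨x, fun x' => by rw [sub_self, ip_zero_right]⟩

lemma Decomposes.add {S : IPMap X Y} {y y' : Y} (h : S.Decomposes y) (h' : S.Decomposes y') :
    S.Decomposes (y + y') := by
  obtain ⟨x, hx⟩ := h
  obtain ⟨x', hx'⟩ := h'
  refine ⟨x + x', fun z => ?_⟩
  rw [map_add, add_sub_add_comm, ip_add_right, hx, hx', add_zero]

/-- Projection in two stages: to the range of `S`, then inside `Y` to the range of `S'`. The second
residual stays orthogonal after `S`, which preserves inner products. -/
lemma Decomposes.comp {S : IPMap Y Z} {S' : IPMap X Y} {z : Z} (h : S.Decomposes z)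
    (h' : ∀ y, S'.Decomposes y) : (S.comp S').Decomposes z := by
  obtain ⟨y, hy⟩ := h
  obtain ⟨x, hx⟩ := h' y
  refine ⟨x, fun x' => ?_⟩
  rw [comp_apply, comp_apply, ← sub_add_sub_cancel z (S y), ip_add_right, hy, ← map_sub, S.ip_map,
    hx, add_zero]

lemma IsAdjointable.decomposes {S : IPMap X Y} (h : S.IsAdjointable) (y : Y) :
    S.Decomposes y := by
  obtain ⟨S', hS'⟩ := h
  refine ⟨S' y, fun x' => ?_⟩
  rw [ip_sub_right, S.ip_map, hS', sub_self]

variable [StarOrderedRing A]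

/-- Pythagoras, `⟨Sx + n, Sx + n⟩ = ⟨x, x⟩ + ⟨n, n⟩`, and monotonicity of the norm on positive
elements. -/
lemma norm_le_norm_apply_add (S : IPMap X Y) (x : X) (n : Y) (hn : ip (S x) n = 0) :
    ‖x‖ ≤ ‖S x + n‖ := by
  rw [norm_eq, norm_eq]
  refine Real.sqrt_le_sqrt (CStarAlgebra.norm_le_norm_of_nonneg_of_le (ip_self_nonneg x) ?_)
  have hn' : ip n (S x) = 0 := by rw [← star_ip, hn, star_zero]
  rw [ip_add_left, ip_add_right, ip_add_right, hn, hn', S.ip_map, add_zero, zero_add]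
  exact le_add_of_nonneg_right (ip_self_nonneg n)

/-- Projecting is contractive, so the coefficients of a convergent sequence are Cauchy, and their
limit serves for the limit vector. This is what lets projections be constructed on dense sets only.
-/
lemma isClosed_decomposes (S : IPMap X Y) : IsClosed {y | S.Decomposes y} := by
  rw [← isSeqClosed_iff_isClosed]
  intro y z hy hz
  choose x hx using hy
  -- The difference of the two residuals is again orthogonal to the range of `S`.
  have hle : ∀ i j, ‖x i - x j‖ ≤ ‖y i - y j‖ := fun i j => by
    have := S.norm_le_norm_apply_add (x i - x j) ((y i - S (x i)) - (y j - S (x j)))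
      (by rw [ip_sub_right, hx, hx, sub_zero])
    rwa [map_sub, sub_sub_sub_comm, add_sub_cancel] at this
  have hc : CauchySeq x := by
    have := hz.cauchySeq
    rw [Metric.cauchySeq_iff'] at this ⊢
    intro ε hε
    obtain ⟨N, hN⟩ := this ε hε
    refine ⟨N, fun n hn => lt_of_le_of_lt ?_ (hN n hn)⟩
    rw [dist_eq_norm, dist_eq_norm]
    exact hle _ _
  obtain ⟨x₀, hx₀⟩ := cauchySeq_tendsto_of_complete hc
  refine ⟨x₀, fun x' => ?_⟩
  have h1 : Filter.Tendsto (fun i => ip (S x') (y i - S (x i))) Filter.atTop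
      (nhds (ip (S x') (z - S x₀))) :=
    (continuous_ip.comp (continuous_const.prodMk continuous_id)).continuousAt.tendsto.comp
      (hz.sub ((S.isometry.continuous.tendsto x₀).comp hx₀))
  simp only [hx] at h1
  exact tendsto_nhds_unique h1 tendsto_const_nhds

end IPMap

namespace HilbertIso

variable {X Y : HilbertModule.{u, v} A}

lemma apply_symm_apply (U : HilbertIso X Y) (y : Y) : U (U.symm y) = y :=
  U.toLinearEquiv.apply_symm_apply y

lemma symm_apply_apply (U : HilbertIso X Y) (x : X) : U.symm (U x) = x :=
  U.toLinearEquiv.symm_apply_apply x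

end HilbertIso

/-- The orthogonal part of `w ∈ W` is `w` minus an element of `V ≤ W`, so it never leaves `W`. -/
lemma IsComplementedIn.of_le {X : HilbertModule.{u, v} A} {V W W' : Submodule ℂ X}
    (h : IsComplementedIn V W') (hW : IsClosedSubmodule W) (hV : V ≤ W) (hle : W ≤ W') :
    IsComplementedIn V W where
  left := h.left
  right := hW
  le := hV
  exists_add w hw := by
    obtain ⟨x, hx, n, -, hn, e⟩ := h.exists_add w (hle hw)
    refine ⟨x, hx, n, ?_, hn, e⟩
    rw [← add_sub_cancel_left x n, ← e]
    exact W.sub_mem hw (hV hx)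

lemma IsClosedSubmodule.map {X Y : HilbertModule.{u, v} A} {V : Submodule ℂ X}
    (h : IsClosedSubmodule V) (S : IPMap X Y) : IsClosedSubmodule (V.map S.toLinearMap) where
  isClosed := by
    have := S.isometry.isClosedEmbedding.isClosedMap _ h.isClosed
    rwa [← Submodule.map_coe] at this
  ract_mem := by
    rintro _ ⟨x, hx, rfl⟩ a
    exact ⟨ract x a, h.ract_mem x hx a, S.map_ract x a⟩

lemma IsComplementedIn.map {X Y : HilbertModule.{u, v} A} {V W : Submodule ℂ X}
    (h : IsComplementedIn V W) (S : IPMap X Y) :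
    IsComplementedIn (V.map S.toLinearMap) (W.map S.toLinearMap) where
  left := h.left.map S
  right := h.right.map S
  le := Submodule.map_mono h.le
  exists_add := by
    rintro _ ⟨w, hw, rfl⟩
    obtain ⟨x, hx, n, hn, hp, e⟩ := h.exists_add w hw
    refine ⟨S x, ⟨x, hx, rfl⟩, S n, ⟨n, hn, rfl⟩, ?_, by rw [e, map_add]⟩
    rintro _ ⟨x', hx', rfl⟩
    rw [S.ip_map, hp x' hx']

lemma IPMap.isComplementedIn_range_top {X Y : HilbertModule.{u, v} A} (S : IPMap X Y)
    (h : ∀ y, S.Decomposes y) : IsComplementedIn S.range ⊤ where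
  left := S.isClosedSubmodule_range
  right := ⟨isClosed_univ, fun _ _ _ => Submodule.mem_top⟩
  le := le_top
  exists_add w _ := by
    obtain ⟨x, hx⟩ := h w
    refine ⟨S x, ⟨x, rfl⟩, w - S x, Submodule.mem_top, ?_, by abel⟩
    rintro _ ⟨x', rfl⟩
    exact hx x'

end

/-! ### Internal tensor products: norm estimate, functoriality, ranges -/

section

variable {A : Type u} [NonUnitalCStarAlgebra A] [PartialOrder A] [StarOrderedRing A]

/-- In the unitization `‖a‖ - a` is some `c⋆ c`, and then `‖a‖⟨m, m⟩ - ⟨m, a m⟩ = ⟨c m, c m⟩ ≥ 0`.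
The unitization is needed since `A` may have no unit; `c` acts through its scalar part and its part
in `A`. -/
lemma Correspondence.ip_left_self_le (M : Correspondence.{u, v} A) {a : A} (ha : 0 ≤ a)
    (m : M.carrier) :
    ip (X := M.toHilbertModule) m (M.left a m) ≤ ‖a‖ • ip (X := M.toHilbertModule) m m := by
  have hsa : IsSelfAdjoint (a : Unitization ℂ A) := (IsSelfAdjoint.of_nonneg ha).inr ℂ
  have h1 : (0 : Unitization ℂ A) ≤ algebraMap ℝ _ ‖(a : Unitization ℂ A)‖ - a :=
    sub_nonneg.mpr hsa.le_algebraMap_norm_self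
  obtain ⟨c, hc⟩ := CStarAlgebra.nonneg_iff_eq_star_mul_self.mp h1
  rw [Unitization.norm_inr] at hc
  have hfst : (‖a‖ : ℂ) = star c.fst * c.fst := by
    simpa [Unitization.algebraMap_eq_inl_comp, sub_eq_add_neg] using congrArg (fun z => z.fst) hc
  have hsnd : -a = star c.fst • c.snd + c.fst • star c.snd + star c.snd * c.snd := by
    simpa [Unitization.algebraMap_eq_inl_comp, sub_eq_add_neg] using congrArg (fun z => z.snd) hc
  -- This is `c · m` for the action of the unitization on `M`.
  let w : M.carrier := c.fst • m + M.left c.snd m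
  have hw : ip (X := M.toHilbertModule) w w
      = ‖a‖ • ip (X := M.toHilbertModule) m m - ip (X := M.toHilbertModule) m (M.left a m) := by
    have hneg : - ip (X := M.toHilbertModule) m (M.left a m)
        = ip (X := M.toHilbertModule) m (M.left (-a) m) := by
      rw [map_neg, ← neg_one_smul ℂ, ← neg_one_smul ℂ (M.left a)]
      exact (ip_smul_right (X := M.toHilbertModule) _ _ _).symm
    rw [sub_eq_add_neg, hneg, hsnd, ← Complex.coe_smul, hfst]
    simp only [w, ip_add_left, ip_add_right, ip_smul_left, ip_smul_right, M.ip_left, map_add,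
      map_smul, map_mul, add_apply, smul_apply, mul_apply_eq_comp, smul_add, mul_comm (star c.fst), mul_smul]
    abel
  have := ip_self_nonneg (X := M.toHilbertModule) w
  rw [hw] at this
  exact sub_nonneg.mp this

/-- The preceding inequality for `a = ⟨x, x⟩`. It makes `x ↦ x ⊗ m` continuous, as the surjectivity
of `R` requires. -/
lemma norm_tmul_le {X : HilbertModule.{u, v} A} {M : Correspondence.{u, v} A} (x : X)
    (m : M.carrier) : ‖tmul x m‖ ≤ ‖x‖ * ‖m‖ := by
  refine le_of_sq_le_sq ?_ (by positivity)
  have hm : ‖m‖ = √‖ip (X := M.toHilbertModule) m m‖ := norm_eq (X := M.toHilbertModule) m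
  rw [mul_pow, norm_eq, norm_eq x, hm, Real.sq_sqrt (norm_nonneg _), Real.sq_sqrt (norm_nonneg _),
    Real.sq_sqrt (norm_nonneg _)]
  have h := CStarAlgebra.norm_le_norm_of_nonneg_of_le (ip_self_nonneg (tmul x m))
    (b := ‖ip x x‖ • ip (X := M.toHilbertModule) m m) (by
      rw [ip_tmul, M.ip_left, star_ip]
      exact M.ip_left_self_le (ip_self_nonneg x) m)
  rwa [norm_smul, norm_norm] at h

variable {X Y Z : HilbertModule.{u, v} A} {M : Correspondence.{u, v} A}

lemma tmul_add_left (x y : X) (m : M.carrier) : tmul (x + y) m = tmul x m + tmul y m := by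
  rw [tmul, TensorProduct.add_tmul, algToTensor_add]; rfl

lemma tmul_smul_left (c : ℂ) (x : X) (m : M.carrier) : tmul (c • x) m = c • tmul x m := by
  rw [tmul, ← TensorProduct.smul_tmul', algToTensor_smul]; rfl

lemma continuous_tmul_left (m : M.carrier) : Continuous fun x : X => (tmul x m : X.tensor M) :=
  (LinearMap.mkContinuous
    ({ toFun := fun x : X => (tmul x m : X.tensor M)
       map_add' := fun x y => tmul_add_left x y m
       map_smul' := fun c x => tmul_smul_left c x m } : X →ₗ[ℂ] X.tensor M) ‖m‖ fun x => by
        rw [mul_comm]; exact norm_tmul_le x m).continuous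

/-- A closed additive condition holds on `X ⊗_A M` if it holds for elementary tensors. -/
lemma tensor_induction_tmul (p : X.tensor M → Prop) (hp : IsClosed {z | p z})
    (htmul : ∀ x m, p (tmul x m)) (hadd : ∀ z w, p z → p w → p (z + w)) (z : X.tensor M) :
    p z := by
  refine tensor_induction p hp (fun t => ?_) z
  induction t using TensorProduct.induction_on with
  | zero =>
    -- Zero is the elementary tensor `0 ⊗ 0`, so it needs no hypothesis of its own.
    have := htmul (0 : X) (0 : M.carrier)
    rwa [tmul, TensorProduct.zero_tmul] at this
  | tmul x m => exact htmul x m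
  | add s t hs ht => rw [algToTensor_add]; exact hadd _ _ hs ht

namespace IPMap

lemma tensorId_comp (S : IPMap Y Z) (S' : IPMap X Y) (z : X.tensor M) :
    S.tensorId M (S'.tensorId M z) = (S.comp S').tensorId M z := by
  refine tensor_induction_tmul (fun z => S.tensorId M (S'.tensorId M z)
    = (S.comp S').tensorId M z) (isClosed_eq ((S.tensorId M).isometry.continuous.comp
      (S'.tensorId M).isometry.continuous) ((S.comp S').tensorId M).isometry.continuous)
    (fun x m => ?_) (fun z w hz hw => ?_) z
  · rw [tensorId_tmul, tensorId_tmul, tensorId_tmul, comp_apply]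
  · rw [map_add, map_add, map_add, hz, hw]

lemma tensorId_of_eq_self (S : IPMap X X) (h : ∀ x, S x = x) (z : X.tensor M) :
    S.tensorId M z = z := by
  refine tensor_induction_tmul (fun z => S.tensorId M z = z)
    (isClosed_eq (S.tensorId M).isometry.continuous continuous_id)
    (fun x m => ?_) (fun z w hz hw => ?_) z
  · rw [tensorId_tmul, h]
  · rw [map_add, hz, hw]

/-- If `x` gives the projection of `y`, then `x ⊗ m` gives that of `y ⊗ m`: the residual is `(y -
Sx) ⊗ m`. Additivity and closedness do the rest, without forming the tensor product of an adjoint.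
-/
lemma decomposes_tensorId (S : IPMap X Y) (h : ∀ y, S.Decomposes y) (z : Y.tensor M) :
    (S.tensorId M).Decomposes z := by
  refine tensor_induction_tmul (S.tensorId M).Decomposes (S.tensorId M).isClosed_decomposes
    (fun y m => ?_) (fun z w hz hw => hz.add hw) z
  obtain ⟨x, hx⟩ := h y
  refine ⟨tmul x m, fun w => ?_⟩
  have e : tmul y m - S.tensorId M (tmul x m) = tmul (y - S x) m := by
    rw [tensorId_tmul, sub_eq_iff_eq_add, ← tmul_add_left, sub_add_cancel]
  rw [e]
  refine tensor_induction_tmul (fun w => ip (S.tensorId M w) (tmul (y - S x) m) = 0)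
    (isClosed_eq (continuous_ip.comp ((S.tensorId M).isometry.continuous.prodMk continuous_const))
      continuous_const) (fun x' m' => ?_) (fun z w hz hw => ?_) w
  · rw [tensorId_tmul, ip_tmul, ← star_ip (S x'), hx, star_zero, map_zero]
    exact ip_zero_left (X := M.toHilbertModule) m
  · rw [map_add, ip_add_left, hz, hw, add_zero]

/-- The range of an isometry on a complete space is closed, so it is the whole closed span and not
merely dense in it. -/
lemma range_tensorId (S : IPMap X Y) : (S.tensorId M).range
    = (Submodule.span ℂ {z : Y.tensor M | ∃ t ∈ S.range, ∃ m : M.carrier, z = tmul t m}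
      ).topologicalClosure := by
  apply le_antisymm
  · rintro _ ⟨z, rfl⟩
    refine tensor_induction_tmul (fun z => S.tensorId M z ∈ (Submodule.span ℂ
      {z : Y.tensor M | ∃ t ∈ S.range, ∃ m : M.carrier, z = tmul t m}).topologicalClosure)
      ((Submodule.isClosed_topologicalClosure _).preimage (S.tensorId M).isometry.continuous)
      (fun x m => ?_) (fun z w hz hw => ?_) z
    · refine Submodule.le_topologicalClosure _ (Submodule.subset_span ?_)
      exact ⟨S x, ⟨x, rfl⟩, m, S.tensorId_tmul M x m⟩
    · rw [map_add]
      exact Submodule.add_mem _ hz hw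
  · refine Submodule.topologicalClosure_minimal _ (Submodule.span_le.mpr ?_)
      (S.tensorId M).isClosedSubmodule_range.isClosed
    rintro _ ⟨_, ⟨x, rfl⟩, m, rfl⟩
    exact ⟨tmul x m, S.tensorId_tmul M x m⟩

lemma subTpow_range (S : IPMap X Y) (k : ℕ) : Y.subTpow S.range M k = (S.tpow M k).range := by
  induction k with
  | zero => rfl
  | succ k ih =>
    rw [HilbertModule.subTpow, ih]
    exact (S.tpow M k).range_tensorId.symm

lemma decomposes_amp (T : IPMap X (X.tensor M)) (h : ∀ y, T.Decomposes y) (k : ℕ) :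
    ∀ y, (T.amp k).Decomposes y := by
  induction k with
  | zero => exact h
  | succ k ih => exact (T.amp k).decomposes_tensorId ih

end IPMap

namespace HilbertIso

/-- The definition applies `U ⊗ id_k` last; here one `U` is applied first instead. The two agree
because `U ⊗ id_{k+1} = (U ⊗ id_k) ⊗ id`. This form fits the relation between `R` and `ι k ⊗ id`. -/
lemma pow_succ_apply (U : HilbertIso X (X.tensor M)) (k : ℕ) (x : X) :
    U.pow (k + 1) x = (U.pow k).toIPMap.tensorId M (U x) := by
  induction k generalizing x with
  | zero => exact ((U.pow 0).toIPMap.tensorId_of_eq_self (fun _ => rfl) (U x)).symm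
  | succ k ih =>
    refine (congrArg ((U.amp k).toIPMap.tensorId M) (ih x)).trans ?_
    exact IPMap.tensorId_comp (U.amp k).toIPMap (U.pow k).toIPMap (U x)

end HilbertIso

/-- Reduces the identities for `Y_k` and for `V_k` to equalities of maps. -/
lemma IPMap.map_range_symm_tpow {Y X : HilbertModule.{u, v} A} {M : Correspondence.{u, v} A}
    (U : HilbertIso X (X.tensor M)) (S : IPMap Y X) (k : ℕ) :
    (X.subTpow S.range M k).map ((U.pow k).symm.toLinearEquiv : X.tpow M k →ₗ[ℂ] X)
      = ((U.pow k).symm.toIPMap.comp (S.tpow M k)).range := by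
  rw [IPMap.subTpow_range]
  exact (LinearMap.range_comp _ _).symm

end

/-! ### Construction of the direct limit -/

section

open Filter

lemma exists_eventually_eq_of_eventually_succ_eq {B : Type*} {f : ℕ → B}
    (h : ∀ᶠ k in atTop, f (k + 1) = f k) : ∃ b, ∀ᶠ k in atTop, f k = b := by
  obtain ⟨N, hN⟩ := eventually_atTop.mp h
  refine ⟨f N, eventually_atTop.mpr ⟨N, fun k hk => ?_⟩⟩
  induction k, hk using Nat.le_induction with
  | base => rfl
  | succ k hk ih => rw [hN k hk, ih]

namespace IPSystem

variable {A : Type u} [NonUnitalCStarAlgebra A] [PartialOrder A]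
  {X : ℕ → HilbertModule.{u, v} A} (T : ∀ k, IPMap (X k) (X (k + 1)))

/-- The sequences `s` with `s (k + 1) = T k (s k)` for all large `k`. -/
def coherent : Submodule ℂ (∀ k, X k) where
  carrier := {s | ∀ᶠ k in atTop, s (k + 1) = T k (s k)}
  add_mem' {s t} hs ht := by
    filter_upwards [hs, ht] with k h h'
    rw [Pi.add_apply, Pi.add_apply, map_add, h, h']
  zero_mem' := .of_forall fun k => (map_zero (T k).toLinearMap).symm
  smul_mem' c s hs := by
    filter_upwards [hs] with k h
    rw [Pi.smul_apply, Pi.smul_apply, map_smul, h]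

/-- The maps `T k` preserve inner products, so `⟨s k, t k⟩` is eventually constant. -/
lemma exists_form (s t : coherent T) :
    ∃ a : A, ∀ᶠ k in atTop, ip (s.1 k) (t.1 k) = a := by
  refine exists_eventually_eq_of_eventually_succ_eq ?_
  filter_upwards [s.2, t.2] with k h h'
  rw [h, h', (T k).ip_map]

/-- The eventual value of `⟨s k, t k⟩`. -/
def form (s t : coherent T) : A := (exists_form T s t).choose

lemma eventually_form (s t : coherent T) : ∀ᶠ k in atTop, ip (s.1 k) (t.1 k) = form T s t :=
  (exists_form T s t).choose_spec

/-- The algebraic direct limit, before vectors of length zero are divided out. -/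
def preLimit : PreHilbert A (coherent T) where
  form := form T
  act a :=
    { toFun := fun s => ⟨fun k => ract (s.1 k) a, by
        filter_upwards [s.2] with k h
        rw [h, (T k).map_ract]⟩
      map_add' := fun s t => Subtype.ext (funext fun k => ract_add _ _ a)
      map_smul' := fun c s => Subtype.ext (funext fun k => ract_smul c _ a) }
  form_add_right r s t := by
    obtain ⟨k, h, h', h''⟩ := ((eventually_form T r (s + t)).and
      ((eventually_form T r s).and (eventually_form T r t))).exists
    rw [← h, ← h', ← h'', ← ip_add_right]
    rfl
  form_smul_right c s t := by
    obtain ⟨k, h, h'⟩ := ((eventually_form T s (c • t)).and (eventually_form T s t)).exists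
    rw [← h, ← h', ← ip_smul_right]
    rfl
  star_form s t := by
    obtain ⟨k, h, h'⟩ := ((eventually_form T s t).and (eventually_form T t s)).exists
    rw [← h, ← h', star_ip]
  form_self_nonneg s := by
    obtain ⟨k, h⟩ := (eventually_form T s s).exists
    rw [← h]
    exact ip_self_nonneg _
  form_act a s t := by
    obtain ⟨k, h, h'⟩ := ((eventually_form T s _).and (eventually_form T s t)).exists
    rw [← h, ← h', ← ip_ract_right]
    rfl

/-- The sequence `0, …, 0, x, T k x, T (k + 1) (T k x), …` with `x` in place `k`. -/
def orbit (k : ℕ) (x : X k) : ∀ j, X j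
  | 0 => if h : k = 0 then h ▸ x else 0
  | j + 1 => if h : k = j + 1 then h ▸ x else T j (orbit k x j)

lemma orbit_self (k : ℕ) (x : X k) : orbit T k x k = x := by
  cases k <;> simp [orbit]

lemma orbit_succ {k j : ℕ} (h : k ≤ j) (x : X k) :
    orbit T k x (j + 1) = T j (orbit T k x j) := by
  rw [orbit, dif_neg (by omega)]

lemma orbit_mem (k : ℕ) (x : X k) : orbit T k x ∈ coherent T :=
  eventually_atTop.mpr ⟨k, fun _ h => orbit_succ T h x⟩

lemma orbit_add (k : ℕ) (x y : X k) : orbit T k (x + y) = orbit T k x + orbit T k y := by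
  funext j
  induction j with
  | zero =>
    by_cases h : k = 0
    · subst h; simp [orbit]
    · simp [orbit, h]
  | succ j ih =>
    by_cases h : k = j + 1
    · subst h; simp [orbit]
    · simp only [orbit, h, dif_neg, not_false_eq_true, Pi.add_apply, ih, map_add]

lemma orbit_smul (k : ℕ) (c : ℂ) (x : X k) : orbit T k (c • x) = c • orbit T k x := by
  funext j
  induction j with
  | zero =>
    by_cases h : k = 0
    · subst h; simp [orbit]
    · simp [orbit, h]
  | succ j ih =>
    by_cases h : k = j + 1
    · subst h; simp [orbit]
    · simp only [orbit, h, dif_neg, not_false_eq_true, Pi.smul_apply, ih, map_smul]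

/-- The orbit of `x` as an element of the algebraic direct limit. -/
def orbitₗ (k : ℕ) : X k →ₗ[ℂ] coherent T where
  toFun x := ⟨orbit T k x, orbit_mem T k x⟩
  map_add' x y := Subtype.ext (orbit_add T k x y)
  map_smul' c x := Subtype.ext (orbit_smul T k c x)

lemma form_orbit (k : ℕ) (x y : X k) : form T (orbitₗ T k x) (orbitₗ T k y) = ip x y := by
  have h : ∀ j, k ≤ j → ip (orbit T k x j) (orbit T k y j) = ip x y := fun j hj => by
    induction j, hj using Nat.le_induction with
    | base => rw [orbit_self, orbit_self]
    | succ j hj ih => rw [orbit_succ T hj, orbit_succ T hj, (T j).ip_map, ih]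
  obtain ⟨j, h', hj⟩ := ((eventually_form T (orbitₗ T k x) (orbitₗ T k y)).and
    (eventually_ge_atTop k)).exists
  rw [← h']
  exact h j hj

lemma form_self_eq_zero {s : coherent T} (h : ∀ᶠ k in atTop, s.1 k = 0) : form T s s = 0 := by
  obtain ⟨k, h, h'⟩ := ((eventually_form T s s).and h).exists
  rw [← h, h', ip_zero_right]

/-- The reason that every class of sequences already comes from a single stage. -/
lemma orbit_eq_of_coherent {s : ∀ k, X k} {N : ℕ} (hs : ∀ k, N ≤ k → s (k + 1) = T k (s k))
    {j : ℕ} (hj : N ≤ j) : orbit T N (s N) j = s j := by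
  induction j, hj using Nat.le_induction with
  | base => rw [orbit_self]
  | succ j hj ih => rw [orbit_succ T hj, hs j hj, ih]

variable [StarOrderedRing A]

/-- The completed direct limit. -/
def limit : HilbertModule.{u, v} A := (preLimit T).completion

/-- The class of a sequence in the direct limit. -/
def toLimit : coherent T →ₗ[ℂ] limit T :=
  (UniformSpace.Completion.toComplL (𝕜 := ℂ) (E := (preLimit T).Space)).toLinearMap ∘ₗ
    (preLimit T).toSpace.toLinearMap

lemma ip_toLimit (s t : coherent T) : ip (toLimit T s) (toLimit T t) = form T s t :=
  congrArg unop ((preLimit T).inner_coe _ _)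

lemma limit_induction (p : limit T → Prop) (hp : IsClosed {z | p z})
    (h : ∀ s, p (toLimit T s)) (z : limit T) : p z :=
  UniformSpace.Completion.induction_on (α := (preLimit T).Space) z hp h

lemma toLimit_eq {s t : coherent T} (h : ∀ᶠ k in atTop, s.1 k = t.1 k) :
    toLimit T s = toLimit T t := by
  rw [← sub_eq_zero, ← map_sub, ← ip_self_eq_zero, ip_toLimit]
  refine form_self_eq_zero T ?_
  filter_upwards [h] with k h
  exact sub_eq_zero.mpr h

/-- The canonical maps into the direct limit. -/
def toLimitMap (k : ℕ) : IPMap (X k) (limit T) where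
  toLinearMap := toLimit T ∘ₗ orbitₗ T k
  ip_map x y := (ip_toLimit T _ _).trans (form_orbit T k x y)

lemma toLimitMap_succ (k : ℕ) (x : X k) : toLimitMap T (k + 1) (T k x) = toLimitMap T k x := by
  refine toLimit_eq T (eventually_atTop.mpr ⟨k + 1, fun j hj => ?_⟩)
  have h := orbit_eq_of_coherent T (s := orbit T k x) (N := k + 1)
    (fun j hj => orbit_succ T (by omega) x) hj
  rwa [orbit_succ T le_rfl, orbit_self] at h

lemma exists_toLimitMap_eq (s : coherent T) :
    ∃ N, ∀ k, N ≤ k → toLimitMap T k (s.1 k) = toLimit T s := by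
  obtain ⟨N, hN⟩ := eventually_atTop.mp s.2
  refine ⟨N, fun k hk => toLimit_eq T (eventually_atTop.mpr ⟨k, fun j hj => ?_⟩)⟩
  exact orbit_eq_of_coherent T (fun j hj => hN j (hk.trans hj)) hj

lemma limit_induction_toLimitMap (p : limit T → Prop) (hp : IsClosed {z | p z})
    (h : ∀ k x, p (toLimitMap T k x)) (z : limit T) : p z := by
  refine limit_induction T p hp (fun s => ?_) z
  obtain ⟨N, hN⟩ := exists_toLimitMap_eq T s
  rw [← hN N le_rfl]
  exact h N _

/-- On a coherent sequence `s` the values `S k (s k)` are eventually constant, and `‖s‖ = ‖s k‖` for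
large `k`; so the bound `C` survives, and the map extends to the completion. -/
lemma exists_desc (Z : HilbertModule.{u, v} A) (S : ∀ k, X k →L[ℂ] Z) (C : ℝ)
    (hS : ∀ (k : ℕ) (x : X k), S (k + 1) (T k x) = S k x) (hC : ∀ k, ‖S k‖ ≤ C) :
    ∃ S' : limit T →L[ℂ] Z, ‖S'‖ ≤ C ∧ ∀ (k : ℕ) (x : X k), S' (toLimitMap T k x) = S k x := by
  have hC0 : 0 ≤ C := (norm_nonneg _).trans (hC 0)
  have hex : ∀ s : coherent T, ∃ z, ∀ᶠ k in atTop, S k (s.1 k) = z := fun s => by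
    refine exists_eventually_eq_of_eventually_succ_eq ?_
    filter_upwards [s.2] with k h
    rw [h, hS]
  choose f hf using hex
  let F : coherent T →ₗ[ℂ] Z :=
    { toFun := f
      map_add' := fun s t => by
        obtain ⟨k, h, h', h''⟩ := ((hf (s + t)).and ((hf s).and (hf t))).exists
        rw [← h, ← h', ← h'', ← map_add]
        rfl
      map_smul' := fun c s => by
        obtain ⟨k, h, h'⟩ := ((hf (c • s)).and (hf s)).exists
        rw [← h, ← h', RingHom.id_apply, ← map_smul]
        rfl }
  have hF : ∀ s : (preLimit T).Space, ‖F s‖ ≤ C * ‖s‖ := fun s => by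
    obtain ⟨k, h, h'⟩ := ((hf s).and (eventually_form T s s)).exists
    have e : ‖s‖ = ‖s.1 k‖ := by
      rw [norm_eq, h']
      rfl
    rw [e]
    refine (congrArg norm h.symm).le.trans (((S k).le_opNorm _).trans ?_)
    exact mul_le_mul_of_nonneg_right (hC k) (norm_nonneg _)
  let G : (preLimit T).Space →L[ℂ] Z :=
    LinearMap.mkContinuous (F : (preLimit T).Space →ₗ[ℂ] Z) C hF
  let G' : limit T →L[ℂ] Z :=
    G.extend (UniformSpace.Completion.toComplL (𝕜 := ℂ) (E := (preLimit T).Space))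
  have hG' : ∀ s, G' (toLimit T s) = f s := fun s =>
    ContinuousLinearMap.extend_eq G (UniformSpace.Completion.denseRange_coe)
      (UniformSpace.Completion.isUniformInducing_coe _) s
  refine ⟨G', ContinuousLinearMap.opNorm_le_bound _ hC0 ?_, fun k x => ?_⟩
  · refine limit_induction T (fun z => ‖G' z‖ ≤ C * ‖z‖) (isClosed_le (by fun_prop) (by fun_prop))
      fun s => ?_
    rw [hG']
    refine (hF s).trans_eq ?_
    congr 1
    exact (UniformSpace.Completion.norm_coe (E := (preLimit T).Space) s).symm
  · refine (hG' _).trans ?_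
    have h : ∀ j, k ≤ j → S j (orbit T k x j) = S k x := fun j hj => by
      induction j, hj using Nat.le_induction with
      | base => rw [orbit_self]
      | succ j hj ih => rw [orbit_succ T hj, hS, ih]
    obtain ⟨j, h', hj⟩ := ((hf (orbitₗ T k x)).and (eventually_ge_atTop k)).exists
    exact h'.symm.trans (h j hj)

theorem isDirectLimit_limit : IsDirectLimit X T (limit T) (toLimitMap T) where
  compat := toLimitMap_succ T
  universal Z S C hS hT hC := by
    obtain ⟨S', hn, hS'⟩ := exists_desc T Z S C hT hC
    refine ⟨S', ⟨fun x a => ?_, hn, hS'⟩, fun S'' h => ContinuousLinearMap.ext fun z => ?_⟩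
    · refine limit_induction_toLimitMap T (fun x => S' (ract x a) = ract (S' x) a)
        (isClosed_eq (S'.continuous.comp (continuous_ract a))
          ((continuous_ract a).comp S'.continuous)) (fun k x => ?_) x
      rw [← IPMap.map_ract, hS', hS', hS]
    · refine limit_induction_toLimitMap T (fun z => S'' z = S' z)
        (isClosed_eq S''.continuous S'.continuous) (fun k x => ?_) z
      rw [h.2.2, hS']

end IPSystem

/-! ### Consequences of the universal property -/

namespace IsDirectLimit

variable {A : Type u} [NonUnitalCStarAlgebra A] [PartialOrder A]
  {X : ℕ → HilbertModule.{u, v} A} {T : ∀ k, IPMap (X k) (X (k + 1))}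
  {L : HilbertModule.{u, v} A} {ι : ∀ k, IPMap (X k) L}

/-- Isometries have norm at most `1`, so `C = 1` serves. Uniqueness is retained because it will
force the stages to be dense. -/
lemma exists_isometric_desc (h : IsDirectLimit X T L ι) {Z : HilbertModule.{u, v} A}
    (S : ∀ k, IPMap (X k) Z) (hS : ∀ (k : ℕ) (x : X k), S (k + 1) (T k x) = S k x) :
    ∃! S' : L →L[ℂ] Z,
      (∀ (x : L) (a : A), S' (ract x a) = ract (S' x) a) ∧ ‖S'‖ ≤ 1 ∧
        ∀ (k : ℕ) (x : X k), S' (ι k x) = S k x :=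
  h.universal Z (fun k => (S k).toIsometry.toContinuousLinearMap) 1
    (fun k => (S k).map_ract) hS (fun k => (S k).toIsometry.norm_toContinuousLinearMap_le)

lemma exists_eq_of_le (h : IsDirectLimit X T L ι) {j k : ℕ} (hjk : j ≤ k) (x : X j) :
    ∃ y, ι k y = ι j x := by
  induction k, hjk using Nat.le_induction with
  | base => exact ⟨x, rfl⟩
  | succ k hk ih =>
    obtain ⟨y, hy⟩ := ih
    exact ⟨T k y, by rw [h.compat, hy]⟩

lemma range_le_succ (h : IsDirectLimit X T L ι) (k : ℕ) : (ι k).range ≤ (ι (k + 1)).range := by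
  rintro _ ⟨x, rfl⟩
  exact ⟨T k x, h.compat k x⟩

/-- Descent from stage `n` to stage `k`, each step projecting along `ι k = ι (k + 1) ∘ T k`. -/
lemma decomposes_apply_of_le (h : IsDirectLimit X T L ι) (hT : ∀ k y, (T k).Decomposes y)
    {k n : ℕ} (hk : k ≤ n) (y : X n) : (ι k).Decomposes (ι n y) := by
  induction hk using Nat.decreasingInduction with
  | self => exact (ι n).decomposes_apply y
  | of_succ k hk ih =>
    have e : (ι (k + 1)).comp (T k) = ι k := IPMap.ext_apply (h.compat k)
    rw [← e]
    exact ih.comp (hT k)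

variable [StarOrderedRing A]

/-- A closed condition holds on a direct limit if it holds on the images of the modules. -/
lemma induction (h : IsDirectLimit X T L ι) (p : L → Prop) (hp : IsClosed {z | p z})
    (hι : ∀ k x, p (ι k x)) (z : L) : p z := by
  have h₀ := IPSystem.isDirectLimit_limit T
  obtain ⟨f, ⟨hf1, hf2, hf3⟩, -⟩ := h.exists_isometric_desc (IPSystem.toLimitMap T) h₀.compat
  obtain ⟨g, ⟨hg1, hg2, hg3⟩, -⟩ := h₀.exists_isometric_desc ι h.compat
  -- Both sides are contractive module maps fixing every `ι k x`, so uniqueness identifies them.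
  -- Hence `g` is onto, and density passes from the concrete limit to `L`.
  have hid : g ∘L f = ContinuousLinearMap.id ℂ L := by
    refine (h.exists_isometric_desc ι h.compat).unique ⟨fun x a => ?_, ?_, fun k x => ?_⟩
      ⟨fun x a => rfl, ContinuousLinearMap.norm_id_le, fun k x => rfl⟩
    · rw [ContinuousLinearMap.comp_apply, hf1, hg1]
      rfl
    · exact (ContinuousLinearMap.opNorm_comp_le g f).trans (mul_le_one₀ hg2 (norm_nonneg _) hf2)
    · rw [ContinuousLinearMap.comp_apply, hf3, hg3]
  have hz : g (f z) = z := congrArg (fun F : L →L[ℂ] L => F z) hid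
  rw [← hz]
  refine IPSystem.limit_induction_toLimitMap T (fun w => p (g w)) (hp.preimage g.continuous)
    (fun k x => ?_) (f z)
  rw [hg3]
  exact hι k x

lemma exists_desc_ipMap (h : IsDirectLimit X T L ι) {Z : HilbertModule.{u, v} A}
    (S : ∀ k, IPMap (X k) Z) (hS : ∀ (k : ℕ) (x : X k), S (k + 1) (T k x) = S k x) :
    ∃ S' : IPMap L Z, ∀ (k : ℕ) (x : X k), S' (ι k x) = S k x := by
  obtain ⟨F, ⟨-, -, hF⟩, -⟩ := h.exists_isometric_desc S hS
  refine ⟨⟨F.toLinearMap, fun z w => ?_⟩, hF⟩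
  refine h.induction (fun z => ip (F z) (F w) = ip z w)
    (isClosed_eq (continuous_ip.comp (F.continuous.prodMk continuous_const))
      (continuous_ip.comp (continuous_id.prodMk continuous_const))) (fun j x => ?_) z
  refine h.induction (fun w => ip (F (ι j x)) (F w) = ip (ι j x) w)
    (isClosed_eq (continuous_ip.comp (continuous_const.prodMk F.continuous))
      (continuous_ip.comp (continuous_const.prodMk continuous_id))) (fun k y => ?_) w
  -- Both vectors are moved to a common stage, where all maps preserve inner products.
  obtain ⟨x', hx'⟩ := h.exists_eq_of_le (le_max_left j k) x
  obtain ⟨y', hy'⟩ := h.exists_eq_of_le (le_max_right j k) y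
  rw [← hx', ← hy', hF, hF, (S _).ip_map, (ι _).ip_map]

lemma decomposes (h : IsDirectLimit X T L ι) (hT : ∀ k y, (T k).Decomposes y) (k : ℕ) (z : L) :
    (ι k).Decomposes z := by
  refine h.induction (ι k).Decomposes (ι k).isClosed_decomposes (fun j y => ?_) z
  obtain ⟨y', hy'⟩ := h.exists_eq_of_le (le_max_left j k) y
  rw [← hy']
  exact h.decomposes_apply_of_le hT (le_max_right j k) y'

lemma univ_subset_closure (h : IsDirectLimit X T L ι) :
    Set.univ ⊆ closure (⋃ k, ((ι k).range : Set L)) := fun z _ =>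
  h.induction (fun z => z ∈ closure (⋃ k, ((ι k).range : Set L))) isClosed_closure
    (fun k x => subset_closure (Set.mem_iUnion.mpr ⟨k, x, rfl⟩)) z

end IsDirectLimit

end

/-! ### The isomorphism `R` and the multi-resolution analysis -/

section

variable {A : Type u} [NonUnitalCStarAlgebra A] [PartialOrder A] [StarOrderedRing A]
  {M : Correspondence.{u, v} A} {Y L : HilbertModule.{u, v} A} {T : IPMap Y (Y.tensor M)}
  {ι : ∀ k, IPMap (Y.tpow M k) L}

namespace IsDirectLimit

/-- The maps `(ι 0 ⊗ id) ∘ T, ι 0 ⊗ id, ι 1 ⊗ id, …`. -/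
def shift (T : IPMap Y (Y.tensor M)) (ι : ∀ k, IPMap (Y.tpow M k) L) :
    ∀ k, IPMap (Y.tpow M k) (L.tensor M)
  | 0 => ((ι 0).tensorId M).comp T
  | k + 1 => (ι k).tensorId M

/-- At stage `0`, which has no predecessor, this holds by the choice of the first map; later it is
the compatibility of `ι` tensored with `id`. -/
lemma shift_succ (h : IsDirectLimit (Y.tpow M) T.amp L ι) (k : ℕ) (y : Y.tpow M k) :
    shift T ι (k + 1) (T.amp k y) = shift T ι k y := by
  cases k with
  | zero => rfl
  | succ k =>
    have e : (ι (k + 1)).comp (T.amp k) = ι k := IPMap.ext_apply (h.compat k)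
    refine (IPMap.tensorId_comp (ι (k + 1)) (T.amp k) y).trans ?_
    rw [e]
    rfl

/-- The isomorphism `R : L → L ⊗_A M` of the direct limit. -/
lemma exists_iso (h : IsDirectLimit (Y.tpow M) T.amp L ι) : ∃ R : HilbertIso L (L.tensor M),
    ∀ (k : ℕ) (y : Y.tpow M (k + 1)), R (ι (k + 1) y) = (ι k).tensorId M y := by
  obtain ⟨R, hR⟩ := h.exists_desc_ipMap (shift T ι) h.shift_succ
  have hsurj : ∀ z, z ∈ R.range := by
    refine tensor_induction_tmul (fun z => z ∈ R.range) R.isClosedSubmodule_range.isClosed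
      (fun z m => ?_) (fun z w hz hw => R.range.add_mem hz hw)
    refine h.induction (fun z => tmul z m ∈ R.range)
      (R.isClosedSubmodule_range.isClosed.preimage (continuous_tmul_left m)) (fun k y => ?_) z
    exact ⟨ι (k + 1) (tmul y m : (Y.tpow M k).tensor M),
      (hR (k + 1) _).trans ((ι k).tensorId_tmul M y m)⟩
  exact ⟨⟨LinearEquiv.ofBijective R.toLinearMap ⟨R.isometry.injective, hsurj⟩, R.ip_map⟩,
    fun k y => hR (k + 1) y⟩

lemma pow_apply (R : HilbertIso L (L.tensor M))
    (hR : ∀ (k : ℕ) (y : Y.tpow M (k + 1)), R (ι (k + 1) y) = (ι k).tensorId M y)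
    (k : ℕ) (y : Y.tpow M k) : R.pow k (ι k y) = (ι 0).tpow M k y := by
  induction k with
  | zero => rfl
  | succ k ih =>
    have e : (R.pow k).toIPMap.comp (ι k) = (ι 0).tpow M k := IPMap.ext_apply ih
    rw [R.pow_succ_apply, hR]
    refine (IPMap.tensorId_comp (R.pow k).toIPMap (ι k) y).trans ?_
    rw [e]
    rfl

lemma isProjectiveMRA (h : IsDirectLimit (Y.tpow M) T.amp L ι) (hT : ∀ y, T.Decomposes y)
    (R : HilbertIso L (L.tensor M))
    (hR : ∀ (k : ℕ) (y : Y.tpow M (k + 1)), R (ι (k + 1) y) = (ι k).tensorId M y) :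
    IsProjectiveMRA R ⊤ (fun k => (ι k).range) := by
  have hc : ∀ k, IsComplementedIn (ι k).range ⊤ := fun k =>
    (ι k).isComplementedIn_range_top (h.decomposes (T.decomposes_amp hT) k)
  refine ⟨hc 0, fun k => ?_, fun k => ?_, fun _ => le_top, h.univ_subset_closure⟩
  · have e : (R.pow k).symm.toIPMap.comp ((ι 0).tpow M k) = ι k := IPMap.ext_apply fun y =>
      (congrArg (R.pow k).symm (pow_apply R hR k y)).symm.trans ((R.pow k).symm_apply_apply _)
    rw [← e]
    exact ((ι 0).map_range_symm_tpow R k).symm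
  · exact (hc k).of_le (ι (k + 1)).isClosedSubmodule_range (h.range_le_succ k) le_top

end IsDirectLimit

/-! ### Transport to a module `X` with an isomorphism `D` -/

namespace IPMap

variable {X : HilbertModule.{u, v} A}

lemma amp_tpow_apply (D : HilbertIso X (X.tensor M)) (Q₀ : IPMap Y X)
    (hQ : ∀ y : Y, D (Q₀ y) = Q₀.tensorId M (T y)) (k : ℕ) (y : Y.tpow M k) :
    D.amp k (Q₀.tpow M k y) = Q₀.tpow M (k + 1) (T.amp k y) := by
  induction k with
  | zero => exact hQ y
  | succ k ih =>
    have e : (D.amp k).toIPMap.comp (Q₀.tpow M k) = (Q₀.tpow M (k + 1)).comp (T.amp k) :=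
      ext_apply ih
    refine (tensorId_comp (D.amp k).toIPMap (Q₀.tpow M k) y).trans ?_
    rw [e]
    exact (tensorId_comp (Q₀.tpow M (k + 1)) (T.amp k) y).symm

/-- The compatibility that produces `Q`: after applying `D^{k+1} = (D ⊗ id_k) ∘ D^k` it becomes the
intertwining relation of `Q₀` tensored with `id_k`. -/
lemma symm_pow_tpow_succ (D : HilbertIso X (X.tensor M)) (Q₀ : IPMap Y X)
    (hQ : ∀ y : Y, D (Q₀ y) = Q₀.tensorId M (T y)) (k : ℕ) (y : Y.tpow M k) :
    (D.pow (k + 1)).symm.toIPMap.comp (Q₀.tpow M (k + 1)) (T.amp k y)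
      = (D.pow k).symm.toIPMap.comp (Q₀.tpow M k) y := by
  apply (D.pow (k + 1)).toLinearEquiv.injective
  refine ((D.pow (k + 1)).apply_symm_apply _).trans ?_
  rw [← amp_tpow_apply D Q₀ hQ]
  exact congrArg (D.amp k) ((D.pow k).apply_symm_apply _).symm

end IPMap

lemma IsDirectLimit.intertwines (h : IsDirectLimit (Y.tpow M) T.amp L ι)
    {R : HilbertIso L (L.tensor M)}
    (hR : ∀ (k : ℕ) (y : Y.tpow M (k + 1)), R (ι (k + 1) y) = (ι k).tensorId M y)
    {X : HilbertModule.{u, v} A} {D : HilbertIso X (X.tensor M)} {Q₀ : IPMap Y X} {Q : IPMap L X}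
    (hQ : ∀ (k : ℕ) (y : Y.tpow M k), D.pow k (Q (ι k y)) = Q₀.tpow M k y) (z : L) :
    D (Q z) = Q.tensorId M (R z) := by
  have key : ∀ (k : ℕ) (y : Y.tpow M (k + 1)),
      D (Q (ι (k + 1) y)) = Q.tensorId M (R (ι (k + 1) y)) := fun k y => by
    -- After `D^k ⊗ id` the left side is `D^{k+1} ∘ Q ∘ ι^{k+1}` and the right side is `(D^k ∘ Q ∘
    -- ι^k) ⊗ id`; both equal `Q_0 ⊗ id_{k+1}`.
    apply ((D.pow k).toIPMap.tensorId M).isometry.injective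
    have e : (D.pow k).toIPMap.comp (Q.comp (ι k)) = Q₀.tpow M k := IPMap.ext_apply (hQ k)
    refine (D.pow_succ_apply k _).symm.trans ((hQ (k + 1) y).trans ?_)
    rw [hR]
    refine .trans ?_ (congrArg ((D.pow k).toIPMap.tensorId M)
      (IPMap.tensorId_comp Q (ι k) y)).symm
    refine .trans ?_ (IPMap.tensorId_comp (D.pow k).toIPMap (Q.comp (ι k)) y).symm
    rw [e]
    rfl
  refine h.induction (fun z => D (Q z) = Q.tensorId M (R z))
    (isClosed_eq (D.toIPMap.isometry.continuous.comp Q.isometry.continuous)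
      ((Q.tensorId M).isometry.continuous.comp R.toIPMap.isometry.continuous)) (fun k y => ?_) z
  -- `R` is given explicitly only on the stages `k + 1`, so the vector is first moved up by one.
  rw [← h.compat k y]
  exact key k _

/-- The image of a projective multi-resolution analysis under an inner-product preserving map. -/
lemma IsProjectiveMRA.map {X : HilbertModule.{u, v} A} {R : HilbertIso L (L.tensor M)}
    {V : ℕ → Submodule ℂ L} (h : IsProjectiveMRA R ⊤ V) (Q : IPMap L X)
    (D : HilbertIso X (X.tensor M))
    (hpow : ∀ k, (V k).map Q.toLinearMap = (X.subTpow ((V 0).map Q.toLinearMap) M k).map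
      ((D.pow k).symm.toLinearEquiv : X.tpow M k →ₗ[ℂ] X)) :
    IsProjectiveMRA D Q.range (fun k => (V k).map Q.toLinearMap) where
  complemented_zero := by
    have := h.complemented_zero.map Q
    rwa [Submodule.map_top] at this
  eq_pow_symm := hpow
  complemented_succ k := (h.complemented_succ k).map Q
  le _ := LinearMap.map_le_range
  dense := by
    rintro _ ⟨z, rfl⟩
    have := image_closure_subset_closure_image Q.isometry.continuous
      ⟨z, h.dense Submodule.mem_top, rfl⟩
    rw [Set.image_iUnion] at this
    exact this

end

end

theorem mainTheorem1 {A : Type u} [NonUnitalCStarAlgebra A] [PartialOrder A]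
    [StarOrderedRing A] (M : Correspondence.{u, v} A) (Y : HilbertModule.{u, v} A)
    (T : IPMap Y (Y.tensor M)) (hT : T.IsAdjointable) :
    (∃ (L : HilbertModule.{u, v} A) (ι : ∀ k, IPMap (Y.tpow M k) L),
      IsDirectLimit (Y.tpow M) T.amp L ι) ∧
    ∀ (L : HilbertModule.{u, v} A) (ι : ∀ k, IPMap (Y.tpow M k) L),
      IsDirectLimit (Y.tpow M) T.amp L ι →
      ∃ R : HilbertIso L (L.tensor M),
        (∀ (k : ℕ) (y : Y.tpow M (k + 1)), R (ι (k + 1) y) = (ι k).tensorId M y) ∧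
        IsProjectiveMRA R ⊤ (fun k => (ι k).range) ∧
        ∀ (X : HilbertModule.{u, v} A) (D : HilbertIso X (X.tensor M)) (Q₀ : IPMap Y X),
          (∀ y : Y, D (Q₀ y) = Q₀.tensorId M (T y)) →
          ∃ Q : IPMap L X,
            (∀ y : Y, Q (ι 0 y) = Q₀ y) ∧
            (∀ z : L, D (Q z) = Q.tensorId M (R z)) ∧
            (∀ k : ℕ, (((ι k).range.map Q.toLinearMap : Submodule ℂ X) : Set X)
              = Set.range fun y : Y.tpow M k => (D.pow k).symm (Q₀.tpow M k y)) ∧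
            IsProjectiveMRA D Q.range (fun k => (ι k).range.map Q.toLinearMap) := by
  have hT' := hT.decomposes
  refine ⟨⟨_, _, IPSystem.isDirectLimit_limit T.amp⟩, fun L ι h => ?_⟩
  obtain ⟨R, hR⟩ := h.exists_iso
  have hmra := h.isProjectiveMRA hT' R hR
  refine ⟨R, hR, hmra, fun X D Q₀ hQ₀ => ?_⟩
  obtain ⟨Q, hQ⟩ := h.exists_desc_ipMap
    (fun k => (D.pow k).symm.toIPMap.comp (Q₀.tpow M k)) (IPMap.symm_pow_tpow_succ D Q₀ hQ₀)
  have hrange : ∀ k, (ι k).range.map Q.toLinearMap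
      = ((D.pow k).symm.toIPMap.comp (Q₀.tpow M k)).range := fun k => by
    rw [← IPMap.ext_apply (S := Q.comp (ι k)) (hQ k)]
    exact (LinearMap.range_comp _ _).symm
  refine ⟨Q, hQ 0, h.intertwines hR (Q₀ := Q₀) fun k y => ?_, fun k => ?_,
    hmra.map Q D fun k => ?_⟩
  · rw [hQ]
    exact (D.pow k).apply_symm_apply _
  · rw [hrange]
    exact LinearMap.coe_range _
  · rw [hrange, hrange]
    -- The rewritten `V_0` is the range of `D^{-0} ∘ (Q_0 ⊗ id_0)`, which is `Q_0` by definition.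
    exact (Q₀.map_range_symm_tpow D k).symm
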